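/- **Setting.** Let $T=(N,E)$, $E\subseteq N\times N$, be a directed tree with an at most countable node set $N$ and root $0\in N$: for every node $i$ there is exactly one directed path from $0$ to $i$ (there are no directed cycles and no edge enters $0$). Let $\deg(i)\in\mathbb N_0\cup\{\infty\}$ be the number of nodes adjacent to $i$ and let $L=\{k\in N\setminus\{0\}:\deg(k)=1\}$ be the set of leaves. Let $P=\{\ell_1,\ell_2,\dots\}\subseteq N\setminus\{0\}$ with $(0,\ell_1),(\ell_1,\ell_2),\dots\in E$ be a path that either ends at a leaf or is infinite, and let $k^*$ be a child of the root, $(0,k^*)\in E$, with $k^*\notin P$ whenever $\deg(0)\ge 2$. A family $X=(X_n)_{n\in N}$ of real random variables is *Markov tree distributed* with respect to $T$ if, for all finite disjoint $A,B\subset N$ and every $i\in N$ that is an inner node of the undirected path between $a$ and $b$ for all $a\in A$, $b\in B$, the vectors $(X_j)_{j\in A}$ and $(X_j)_{j\in B}$ are conditionally independent given $X_i$. We write $V\uparrow_{st}U$ if the conditional distribution of $V$ given $U=u$ is increasing in $u$ in the usual stochastic order, outside a null set of the distribution of $U$. A function $f:\mathbb R^d\to\mathbb R$ is supermodular if $f(x)+f(y)\le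 f(x\wedge y)+f(x\vee y)$ for all $x,y$. A *weight* is a measurable $b:\mathbb R^d\to[1,\infty)$ such that $b(y)\le b(x)$ whenever every $y_i$ lies between $0$ and $x_i$ (for instance $b\equiv1$ or $b(x)=\max\{1,\|x\|^p\}$). For random vectors, $V\le_{sm}W$ means $\mathbb E f(V)\le\mathbb E f(W)$ for every measurable supermodular $f$ for which there is a weight $b$ with $\mathbb E\,b(V)<\infty$, $\mathbb E\,b(W)<\infty$ and $\sup_x|f(x)|/b(x)<\infty$. For families indexed by $N$, $V\le_{sm}W$ means $(V_{n_1},\dots,V_{n_m})\le_{sm}(W_{n_1},\dots,W_{n_m})$ for all $m$ and all $n_1,\dots,n_m\in N$. A vector or family $V$ is *positive supermodular dependent* (PSMD) if $V^\perp\le_{sm}V$, where $V^\perp$ has independent components with the same marginal distributions as $V$. **Theorem.** Let $X=(X_n)_{n\in N}$ and $Y=(Y_n)_{n\in N}$ be Markov tree distributed with respect to $T$. Assume for all $(i,j)\in E$ that 1. $X_j\uparrow_{st}X_i$ if $j\ne k^*$; 2. $Y_i\uparrow_{st}Y_j$ if $j\notin L$, and $Y_j\uparrow_{st}Y_i$ if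 $j\notin P$. Then the following hold. - If $(X_i,X_j)\le_{sm}(Y_i,Y_j)$ for all $(i,j)\in E$, then $X\le_{sm}Y$. - If $(X_i,X_j)\ge_{sm}(Y_i,Y_j)$ for all $(i,j)\in E$, then $X\ge_{sm}Y$. - If $(X_0,X_{k^*})$ is PSMD, then $X$ is PSMD. - If $(Y_i,Y_j)$ is PSMD for every $(i,j)\in E$ with $j\in P\cap L$, then $Y$ is PSMD. -/

import Mathlib

open MeasureTheory ProbabilityTheory

noncomputable section

namespace MarkovTree

/-- A directed tree (arborescence) on the node set `N`: from the root to every node there is exactly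
one directed path, given by its list of nodes. For the root itself this is the list `[root]`, so
there are no directed cycles and no edge enters the root. -/
structure DirTree (N : Type*) where
  root : N
  E : N → N → Prop
  existsUnique_path : ∀ i : N, ∃! p : List N,
    p.IsChain E ∧ p.head? = some root ∧ p.getLast? = some i

namespace DirTree

variable {N : Type*} (T : DirTree N)

/-- The number of nodes adjacent to `i`, possibly infinite. -/
def deg (i : N) : ℕ∞ := {j | T.E i j ∨ T.E j i}.encard

/-- The set of leaves; the root is never a leaf. -/
def leaves : Set N := {k | k ≠ T.root ∧ T.deg k = 1}

/-- The set `P` of nodes, without the root, of a directed path that starts at the root and either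
ends at a leaf or is infinite. -/
def IsRootPath (P : Set N) : Prop :=
  (∃ l : List N, ∃ k ∈ T.leaves,
      (T.root :: l).IsChain T.E ∧ l.getLast? = some k ∧ P = {n | n ∈ l}) ∨
  (∃ l : ℕ → N, T.E T.root (l 0) ∧ (∀ n, T.E (l n) (l (n + 1))) ∧ P = Set.range l)

/-- The underlying undirected graph. -/
def graph : SimpleGraph N := SimpleGraph.fromRel T.E

/-- The node `i` separates `A` and `B`: it is an inner node of the undirected path between `a` and
`b`, for all `a ∈ A` and `b ∈ B`. -/
def Separates (i : N) (A B : Finset N) : Prop :=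
  ∀ a ∈ A, ∀ b ∈ B, i ≠ a ∧ i ≠ b ∧ ∀ w : T.graph.Walk a b, w.IsPath → i ∈ w.support

/-- Markov tree dependence of a distribution `P` on `ℝ^N`, stated for the coordinate process. -/
def IsMarkov [Countable N] (P : Measure (N → ℝ)) [IsFiniteMeasure P] : Prop :=
  ∀ (A B : Finset N) (i : N), Disjoint A B → T.Separates i A B →
    CondIndepFun (MeasurableSpace.comap (fun x : N → ℝ => x i) inferInstance)
      (measurable_pi_apply i).comap_le
      (fun x (j : A) => x j) (fun x (j : B) => x j) P

end DirTree

/-- The stochastic order `ρ ≤_st σ` for distributions on `ℝ`. -/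
def StLE (ρ σ : Measure ℝ) : Prop :=
  ∀ f : ℝ → ℝ, Monotone f → Integrable f ρ → Integrable f σ → ∫ x, f x ∂ρ ≤ ∫ x, f x ∂σ

/-- `V ↑_st U`: the conditional distribution of `V` given `U = u` is `≤_st`-increasing in `u`
outside a null set of the distribution of `U`. -/
def StochIncr {Ω : Type*} [MeasurableSpace Ω] (μ : Measure Ω) [IsFiniteMeasure μ]
    (V U : Ω → ℝ) : Prop :=
  ∃ s : Set ℝ, μ.map U s = 0 ∧ ∀ u ∉ s, ∀ u' ∉ s, u ≤ u' →
    StLE (condDistrib V U μ u) (condDistrib V U μ u')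

/-- Supermodular functions on `ℝ^ι`; `⊓` and `⊔` are taken componentwise. -/
def Supermodular {ι : Type*} (f : (ι → ℝ) → ℝ) : Prop :=
  ∀ x y, f x + f y ≤ f (x ⊓ y) + f (x ⊔ y)

/-- Weight functions `b : ℝ^ι → [1, ∞)`, such as `max {1, ‖x‖ ^ p}`: measurable, and increasing
in each coordinate as that coordinate moves away from `0`. -/
structure IsWeight {ι : Type*} (b : (ι → ℝ) → ℝ) : Prop where
  measurable : Measurable b
  one_le : ∀ x, 1 ≤ b x
  mono : ∀ x y, (∀ i, y i ∈ Set.uIcc 0 (x i)) → b y ≤ b x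

/-- The supermodular order for distributions of random vectors: comparison of the expectations of
all measurable supermodular functions that are `b`-bounded, for any weight `b` that is integrable
under both distributions. -/
def SmLE {ι : Type*} [Finite ι] (P Q : Measure (ι → ℝ)) : Prop :=
  ∀ b : (ι → ℝ) → ℝ, IsWeight b → Integrable b P → Integrable b Q →
    ∀ f : (ι → ℝ) → ℝ, Measurable f → Supermodular f → (∃ C : ℝ, ∀ x, |f x| ≤ C * b x) →
      ∫ x, f x ∂P ≤ ∫ x, f x ∂Q

/-- The supermodular order for distributions of processes: comparison of all finite-dimensional
marginal distributions. -/
def ProcSmLE {N : Type*} (P Q : Measure (N → ℝ)) : Prop :=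
  ∀ (m : ℕ) (n : Fin m → N),
    SmLE (P.map fun x (k : Fin m) => x (n k)) (Q.map fun x (k : Fin m) => x (n k))

section RandomVariables

variable {N Ω : Type*} [MeasurableSpace Ω]

/-- The law of the family `X` on `ℝ^N`. -/
def law (μ : Measure Ω) (X : N → Ω → ℝ) : Measure (N → ℝ) := μ.map fun ω n => X n ω

instance (μ : Measure Ω) [IsFiniteMeasure μ] (X : N → Ω → ℝ) : IsFiniteMeasure (law μ X) := by
  unfold law; infer_instance

/-- The law on `ℝ^N` of a family of independent variables with the same marginals as `X`. -/
def indepLaw (μ : Measure Ω) (X : N → Ω → ℝ) : Measure (N → ℝ) :=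
  Measure.infinitePi fun n => μ.map (X n)

/-- Positive supermodular dependence of a random vector. -/
def PSMD [Finite N] (μ : Measure Ω) (X : N → Ω → ℝ) : Prop := SmLE (indepLaw μ X) (law μ X)

/-- Positive supermodular dependence of a process. -/
def ProcPSMD (μ : Measure Ω) (X : N → Ω → ℝ) : Prop := ProcSmLE (indepLaw μ X) (law μ X)

end RandomVariables

end MarkovTree

end

noncomputable section

namespace MarkovTree

/-! ### Bounded test functions and resampling of one coordinate -/

/-! Truncation reduces every order statement to bounded supermodular functions `f` of the
coordinates in a finite parent-closed set `S`. The comparison (`supermodular_comparison`) is an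
induction that removes one leaf `j` of `S`, with parent `i`, at a time. Let `P` be the law of `X`,
`Q` that of `Y`, and let `κ` be the conditional law of `X_j` given `X_i`. Write `κf` for `f` with
coordinate `j` resampled by `κ`. Since `∫ f dP = ∫ κf dP`, `∫ f dQ - ∫ f dP = (∫ f dQ - ∫ κf dQ) +
(∫ κf dQ - ∫ κf dP)`. The second bracket is the induction hypothesis: `κf` no longer involves `j`,
and it is supermodular because `κ` is stochastically increasing (`Supermodular.resample`). In the
first bracket all coordinates other than `i` and `j` are integrated out under `Q`, turning `f` into
a supermodular `g` of `(x_i, x_j)` (`Reduces`). The marginals at `i` agree, so the bracket becomes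
`∫ g dQ - ∫ g dP`, whose sign is the assumption on pairs.

Integrating out under `Q` uses increasing conditional laws of a child given its parent off the
ancestors of `j`, and of a parent given its child along the ancestors of `i`. The first kind may
fail on the root path, so `j` is chosen below every node of that path in `S`
(`exists_leaf_below_rootPath`).

Monotonicity of conditional laws holds only off null sets, so kernels are replaced by monotone ones
that agree with them up to small mass, and all identities hold up to `ε`. The two dependence
statements are comparisons with an independent family, which is Markov for every tree. -/

/-- Measurable functions on `ℝ^N`, bounded by `M`, that depend on the coordinates in `S` only. -/
structure BddMeasOn {N : Type*} (M : ℝ) (S : Set N) (f : (N → ℝ) → ℝ) : Prop where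
  measurable : Measurable f
  bound : ∀ x, |f x| ≤ M
  dependsOn : DependsOn f S

/-- Replace the coordinate `j` by a random one, distributed as `κ` given the coordinate `i`. -/
def resample {N : Type*} [DecidableEq N] (κ : Kernel ℝ ℝ) (i j : N) (f : (N → ℝ) → ℝ)
    (x : N → ℝ) : ℝ :=
  ∫ t, f (Function.update x j t) ∂κ (x i)

/-- Kernels that are increasing in the stochastic order. -/
def MonoKernel (κ : Kernel ℝ ℝ) : Prop := ∀ u u', u ≤ u' → StLE (κ u) (κ u')

section Resample

variable {N : Type*} {M : ℝ} {S : Set N} {f : (N → ℝ) → ℝ}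

theorem BddMeasOn.integrable (hf : BddMeasOn M S f) (P : Measure (N → ℝ)) [IsFiniteMeasure P] :
    Integrable f P :=
  Integrable.of_bound hf.measurable.aestronglyMeasurable M (ae_of_all _ hf.bound)

theorem BddMeasOn.mono {S' : Set N} (hf : BddMeasOn M S f) (h : S ⊆ S') : BddMeasOn M S' f :=
  ⟨hf.measurable, hf.bound, hf.dependsOn.mono h⟩

variable [DecidableEq N]

theorem measurable_update_prod (j : N) :
    Measurable fun p : (N → ℝ) × ℝ => Function.update p.1 j p.2 := by
  refine measurable_pi_lambda _ fun n => ?_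
  by_cases h : n = j
  · subst h; simpa using measurable_snd
  · simpa [Function.update_of_ne h] using measurable_fst.eval

theorem BddMeasOn.integrable_update (hf : BddMeasOn M S f) (x : N → ℝ) (j : N) (ρ : Measure ℝ)
    [IsFiniteMeasure ρ] : Integrable (fun t => f (Function.update x j t)) ρ :=
  Integrable.of_bound
    (hf.measurable.comp ((measurable_update_prod j).comp measurable_prodMk_left)).aestronglyMeasurable
    M (ae_of_all _ fun _ => hf.bound _)

theorem measurable_resample {κ : Kernel ℝ ℝ} [IsMarkovKernel κ] (hf : Measurable f) (i j : N) :
    Measurable (resample κ i j f) := by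
  have h : StronglyMeasurable fun p : (N → ℝ) × ℝ => f (Function.update p.1 j p.2) :=
    (hf.comp (measurable_update_prod j)).stronglyMeasurable
  exact (h.integral_kernel_prod_right'
    (κ := κ.comap (fun x : N → ℝ => x i) (measurable_pi_apply i))).measurable

theorem abs_resample_le {κ : Kernel ℝ ℝ} [IsMarkovKernel κ] (hf : ∀ x, |f x| ≤ M) (i j : N)
    (x : N → ℝ) : |resample κ i j f x| ≤ M := by
  have := norm_integral_le_of_norm_le_const (μ := κ (x i)) (C := M)
    (f := fun t => f (Function.update x j t)) (ae_of_all _ fun t => hf _)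
  simpa [resample] using this

theorem dependsOn_resample {κ : Kernel ℝ ℝ} (hf : DependsOn f S) (i j : N) :
    DependsOn (resample κ i j f) (insert i (S \ {j})) := by
  intro x y hxy
  have hi : x i = y i := hxy i (Set.mem_insert _ _)
  simp only [resample, hi]
  congr 1 with t
  refine hf fun n hn => ?_
  by_cases h : n = j
  · subst h; simp
  · simpa [Function.update_of_ne h] using hxy n (Or.inr ⟨hn, h⟩)

theorem BddMeasOn.resample (hf : BddMeasOn M S f) (κ : Kernel ℝ ℝ) [IsMarkovKernel κ] (i j : N) :
    BddMeasOn M (insert i (S \ {j})) (resample κ i j f) :=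
  ⟨measurable_resample hf.measurable i j, abs_resample_le hf.bound i j,
    dependsOn_resample hf.dependsOn i j⟩

theorem update_inf_update (x y : N → ℝ) (j : N) (s t : ℝ) :
    Function.update x j s ⊓ Function.update y j t = Function.update (x ⊓ y) j (s ⊓ t) := by
  ext n
  by_cases h : n = j
  · subst h; simp
  · simp [Function.update_of_ne h]

theorem update_sup_update (x y : N → ℝ) (j : N) (s t : ℝ) :
    Function.update x j s ⊔ Function.update y j t = Function.update (x ⊔ y) j (s ⊔ t) := by
  ext n
  by_cases h : n = j
  · subst h; simp
  · simp [Function.update_of_ne h]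

/-- Let `x i ≤ y i`. Supermodularity makes `f (x ⊔ y, t) - f (y, t)` increasing in `t`, so its
integral grows from `κ (x i)` to `κ (y i)`. Add to this the pointwise supermodular inequality
integrated against `κ (x i)`. -/
theorem Supermodular.resample {κ : Kernel ℝ ℝ} [IsMarkovKernel κ] (hκ : MonoKernel κ)
    (hf : BddMeasOn M S f) (hs : Supermodular f) (i j : N) :
    Supermodular (resample κ i j f) := by
  have key : ∀ x y : N → ℝ, x i ≤ y i → MarkovTree.resample κ i j f x + MarkovTree.resample κ i j f y ≤
      MarkovTree.resample κ i j f (x ⊓ y) + MarkovTree.resample κ i j f (x ⊔ y) := by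
    intro x y hxy
    have hi : (x ⊓ y) i = x i := by simpa using hxy
    have hs' : (x ⊔ y) i = y i := by simpa using hxy
    simp only [MarkovTree.resample, hi, hs']
    have I := fun (z : N → ℝ) (u : ℝ) => hf.integrable_update z j (κ u)
    have hmono : Monotone fun t => f (Function.update (x ⊔ y) j t) - f (Function.update y j t) := by
      intro s t hst
      have := hs (Function.update (x ⊔ y) j s) (Function.update y j t)
      rw [update_inf_update, update_sup_update, inf_eq_right.2 le_sup_right,
        sup_eq_left.2 le_sup_right, inf_eq_left.2 hst, sup_eq_right.2 hst] at this
      simp only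
      linarith
    have h1 := hκ _ _ hxy _ hmono ((I _ _).sub (I _ _)) ((I _ _).sub (I _ _))
    rw [integral_sub (I _ _) (I _ _), integral_sub (I _ _) (I _ _)] at h1
    have h2 : ∫ t, (f (Function.update x j t) + f (Function.update y j t)) ∂κ (x i) ≤
        ∫ t, (f (Function.update (x ⊓ y) j t) + f (Function.update (x ⊔ y) j t)) ∂κ (x i) := by
      refine integral_mono ((I _ _).add (I _ _)) ((I _ _).add (I _ _)) fun t => ?_
      have := hs (Function.update x j t) (Function.update y j t)
      rwa [update_inf_update, update_sup_update, inf_idem, sup_idem] at this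
    rw [integral_add (I _ _) (I _ _), integral_add (I _ _) (I _ _)] at h2
    linarith
  intro x y
  rcases le_total (x i) (y i) with h | h
  · exact key x y h
  · have := key y x h
    rw [inf_comm, sup_comm] at this
    linarith

/-- Fubini applies because neither resampled coordinate is one on which the other kernel is
conditioned. -/
theorem resample_comm (hf : BddMeasOn M S f) (κ κ' : Kernel ℝ ℝ) [IsMarkovKernel κ]
    [IsMarkovKernel κ'] {i j i' j' : N} (hjj : j ≠ j') (hij : i ≠ j') (hij' : i' ≠ j) :
    resample κ i j (resample κ' i' j' f) = resample κ' i' j' (resample κ i j f) := by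
  ext x
  simp only [resample, Function.update_of_ne hij, Function.update_of_ne hij']
  rw [integral_integral_swap]
  · simp only [Function.update_comm hjj]
  · refine Integrable.of_bound (C := M) (Measurable.aestronglyMeasurable ?_)
      (ae_of_all _ fun _ => hf.bound _)
    have h1 : Measurable fun p : ℝ × ℝ => ((Function.update x j p.1, p.2) : (N → ℝ) × ℝ) :=
      (((measurable_update_prod j).comp measurable_prodMk_left).comp measurable_fst).prodMk
        measurable_snd
    exact hf.measurable.comp ((measurable_update_prod j').comp h1)

end Resample

/-! ### Monotone versions of stochastically increasing kernels -/

/-- Send `x` to the largest point of `K` below `max x (sInf K)`. -/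
theorem exists_monotone_retraction {K : Set ℝ} (hK : IsCompact K) (hne : K.Nonempty) :
    ∃ r : ℝ → ℝ, Monotone r ∧ (∀ x, r x ∈ K) ∧ ∀ x ∈ K, r x = x := by
  have hne' : ∀ x, (K ∩ Set.Iic (max x (sInf K))).Nonempty := fun x =>
    ⟨sInf K, hK.sInf_mem hne, Set.mem_Iic.2 (le_max_right _ _)⟩
  have hc : ∀ x, IsCompact (K ∩ Set.Iic (max x (sInf K))) := fun x => hK.inter_right isClosed_Iic
  refine ⟨fun x => sSup (K ∩ Set.Iic (max x (sInf K))), fun x y hxy => ?_,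
    fun x => ((hc x).sSup_mem (hne' x)).1, fun x hx => ?_⟩
  · exact csSup_le_csSup (hc y).bddAbove (hne' x)
      (Set.inter_subset_inter_right _ (Set.Iic_subset_Iic.2 (max_le_max hxy le_rfl)))
  · have hm : max x (sInf K) = x := max_eq_left (csInf_le hK.bddBelow hx)
    simp only [hm]
    exact le_antisymm (csSup_le ⟨x, hx, Set.mem_Iic.2 le_rfl⟩ fun y hy => hy.2)
      (le_csSup (hK.inter_right isClosed_Iic).bddAbove ⟨hx, Set.mem_Iic.2 le_rfl⟩)

/-- Inner regularity gives a compact `K` off the exceptional null set with almost full mass.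
Composing the conditional law with a monotone retraction onto `K` makes it increasing everywhere and
leaves it unchanged on `K`. -/
theorem StochIncr.exists_monoKernel {Ω : Type*} [MeasurableSpace Ω] {μ : Measure Ω}
    [IsProbabilityMeasure μ] {V U : Ω → ℝ} (hU : Measurable U) (h : StochIncr μ V U)
    {ε : ℝ} (hε : 0 < ε) :
    ∃ κ : Kernel ℝ ℝ, IsMarkovKernel κ ∧ MonoKernel κ ∧ ∃ A : Set ℝ, MeasurableSet A ∧
      (μ.map U).real Aᶜ ≤ ε ∧ ∀ u ∈ A, κ u = condDistrib V U μ u := by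
  obtain ⟨s, hs, hmono⟩ := h
  have : IsProbabilityMeasure (μ.map U) := Measure.isProbabilityMeasure_map hU.aemeasurable
  set m := μ.map U
  have hG : MeasurableSet (toMeasurable m s)ᶜ := (measurableSet_toMeasurable m s).compl
  have hG1 : m (toMeasurable m s)ᶜ = 1 := by
    rw [prob_compl_eq_one_iff (measurableSet_toMeasurable m s), measure_toMeasurable, hs]
  -- The cap `1 / 2` keeps `K` nonempty when `ε` is large.
  have hε' : ENNReal.ofReal (min ε (1 / 2)) ≠ 0 := by
    rw [Ne, ENNReal.ofReal_eq_zero, not_le]; positivity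
  obtain ⟨K, hKG, hK, hKm⟩ := hG.exists_isCompact_lt_add (measure_ne_top m _) hε'
  have hKm' : m.real Kᶜ ≤ min ε (1 / 2) := by
    rw [hG1] at hKm
    have h2 : (1 : ℝ) < m.real K + min ε (1 / 2) := by
      have := (ENNReal.toReal_lt_toReal (by simp) (by simp)).2 hKm
      rwa [ENNReal.toReal_add (measure_ne_top _ _) (by simp), ENNReal.toReal_ofReal (by positivity),
        ENNReal.toReal_one] at this
    rw [probReal_compl_eq_one_sub hK.measurableSet]
    linarith
  have hne : K.Nonempty := by
    by_contra hne
    rw [Set.not_nonempty_iff_eq_empty] at hne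
    subst hne
    have := hKm'.trans (min_le_right _ _)
    simp at this
    norm_num at this
  obtain ⟨r, hr, hrK, hrid⟩ := exists_monotone_retraction hK hne
  have hrs : ∀ x, r x ∉ s := fun x hx => hKG (hrK x) (subset_toMeasurable m s hx)
  refine ⟨(condDistrib V U μ).comap r hr.measurable, inferInstance, fun u u' huu' => ?_, K,
    hK.measurableSet, hKm'.trans (min_le_left _ _), fun u hu => ?_⟩
  · simp only [Kernel.comap_apply]
    exact hmono _ (hrs u) _ (hrs u') (hr huu')
  · simp [Kernel.comap_apply, hrid u hu]

/-- Two kernels that agree off a set of small mass give nearly the same integrals. -/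
theorem abs_integral_resample_sub_le {N : Type*} [DecidableEq N] {P : Measure (N → ℝ)}
    [IsProbabilityMeasure P] {M ε : ℝ} {S : Set N} {f : (N → ℝ) → ℝ} (hf : BddMeasOn M S f)
    (κ κ' : Kernel ℝ ℝ) [IsMarkovKernel κ] [IsMarkovKernel κ'] {i j : N} {A : Set ℝ}
    (hA : MeasurableSet A) (hAε : (P.map fun x => x i).real Aᶜ ≤ ε) (h : ∀ u ∈ A, κ' u = κ u) :
    |∫ x, resample κ i j f x ∂P - ∫ x, resample κ' i j f x ∂P| ≤ 2 * M * ε := by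
  have hM : 0 ≤ M := (abs_nonneg _).trans (hf.bound 0)
  have h1 := hf.resample κ i j
  have h2 := hf.resample κ' i j
  rw [← integral_sub (h1.integrable P) (h2.integrable P)]
  have hAi : MeasurableSet ((fun x : N → ℝ => x i) ⁻¹' Aᶜ) := measurable_pi_apply i hA.compl
  calc |∫ x, (resample κ i j f x - resample κ' i j f x) ∂P|
      ≤ ∫ x, |resample κ i j f x - resample κ' i j f x| ∂P := abs_integral_le_integral_abs
    _ ≤ ∫ x, ((fun x : N → ℝ => x i) ⁻¹' Aᶜ).indicator (fun _ => 2 * M) x ∂P := by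
        refine integral_mono ((h1.integrable P).sub (h2.integrable P)).abs
          ((integrable_const _).indicator hAi) fun x => ?_
        by_cases hx : x i ∈ A
        · have : x ∉ (fun x : N → ℝ => x i) ⁻¹' Aᶜ := by simpa using hx
          rw [Set.indicator_of_notMem this]
          simp [resample, h _ hx]
        · have : x ∈ (fun x : N → ℝ => x i) ⁻¹' Aᶜ := hx
          simp only [Set.indicator_of_mem this]
          have a := abs_le.1 (h1.bound x)
          have b := abs_le.1 (h2.bound x)
          rw [abs_le]; constructor <;> linarith
    _ = 2 * M * (P.map fun x => x i).real Aᶜ := by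
        rw [integral_indicator_const _ hAi, map_measureReal_apply (measurable_pi_apply i) hA.compl]
        simp [mul_comm]
    _ ≤ 2 * M * ε := by gcongr

/-! ### Integrating out a separated coordinate -/

/-- In a Markov tree, a coordinate that is separated by `i` from the other ones may be resampled
given the coordinate `i`. -/
theorem DirTree.IsMarkov.integral_resample {N : Type*} [Countable N] [DecidableEq N]
    {T : DirTree N} {P : Measure (N → ℝ)} [IsProbabilityMeasure P] (hP : T.IsMarkov P) {i j : N}
    (hij : i ≠ j) {S : Finset N} (hsep : T.Separates i {j} ((S.erase j).erase i)) {M : ℝ}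
    {f : (N → ℝ) → ℝ} (hf : BddMeasOn M (S : Set N) f) :
    ∫ x, resample (condDistrib (fun x : N → ℝ => x j) (fun x => x i) P) i j f x ∂P =
      ∫ x, f x ∂P := by
  set B := (S.erase j).erase i with hB
  set κ := condDistrib (fun x : N → ℝ => x j) (fun x => x i) P with hκ
  let g : (N → ℝ) → B → ℝ := fun x b => x b
  have hg : Measurable g := measurable_pi_lambda _ fun b => measurable_pi_apply _
  have hi : Measurable fun x : N → ℝ => x i := measurable_pi_apply i
  have hj : Measurable fun x : N → ℝ => x j := measurable_pi_apply j
  have hdisj : Disjoint ({j} : Finset N) B := by simp [hB]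
  have hci := hP {j} B i hdisj hsep
  have hev : Measurable fun v : ({j} : Finset N) → ℝ => v ⟨j, by simp⟩ := measurable_pi_apply _
  have hci' := hci.comp hev measurable_id
  have hlaw := (condDistrib_ae_eq_iff_measure_eq_compProd (μ := P) _ hj.aemeasurable _).1
    ((condIndepFun_iff_condDistrib_prod_ae_eq_prodMkRight hj hg hi).1 hci'.symm)
  -- `φ` rebuilds a point from its coordinates in `B` and at `i`; the default `0` elsewhere is
  -- harmless, since `f` sees only `S` and coordinate `j` is overwritten.
  let φ : ℝ × (B → ℝ) → N → ℝ := fun p n =>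
    if n = i then p.1 else if h : n ∈ B then p.2 ⟨n, h⟩ else 0
  have hφ : Measurable φ := by
    refine measurable_pi_lambda _ fun n => ?_
    by_cases h : n = i
    · simpa [φ, h] using measurable_fst
    · by_cases h' : n ∈ B
      · simpa [φ, h, h'] using measurable_snd.eval
      · simp [φ, h, h']
  let F : (ℝ × (B → ℝ)) × ℝ → ℝ := fun p => f (Function.update (φ p.1) j p.2)
  have hF : Measurable F :=
    hf.measurable.comp ((measurable_update_prod j).comp
      ((hφ.comp measurable_fst).prodMk measurable_snd))
  have hfF : ∀ x t, f (Function.update x j t) = F ((x i, g x), t) := by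
    intro x t
    refine hf.dependsOn fun n hn => ?_
    by_cases h : n = j
    · subst h; simp
    · simp only [Function.update_of_ne h]
      by_cases h' : n = i
      · simp [φ, h']
      · have : n ∈ B := by simp [hB, h, h']; exact hn
        simp [φ, h', this, g]
  have hgi : Measurable fun x => (x i, g x) := hi.prodMk hg
  have h1 : ∫ x, f x ∂P = ∫ p, F p ∂(P.map fun x => ((x i, g x), x j)) := by
    rw [integral_map (hgi.prodMk hj).aemeasurable hF.aestronglyMeasurable]
    refine integral_congr_ae (ae_of_all _ fun x => ?_)
    simp only [← hfF, Function.update_eq_self]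
  have hFi : Integrable F (P.map fun x => ((x i, g x), x j)) := by
    have : IsProbabilityMeasure (P.map fun x => ((x i, g x), x j)) :=
      Measure.isProbabilityMeasure_map (hgi.prodMk hj).aemeasurable
    exact Integrable.of_bound hF.aestronglyMeasurable M (ae_of_all _ fun _ => hf.bound _)
  rw [h1]
  rw [hlaw] at hFi ⊢
  rw [Measure.integral_compProd hFi, integral_map hgi.aemeasurable]
  · refine integral_congr_ae (ae_of_all _ fun x => ?_)
    simp only [resample, hfF]
    rfl
  · exact (hF.stronglyMeasurable.integral_kernel_prod_right'
      (κ := κ.prodMkRight (B → ℝ))).aestronglyMeasurable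

/-! ### Combinatorics of directed trees -/

namespace DirTree

variable {N : Type*} (T : DirTree N)

/-- The directed path from the root to `i`. -/
def path (i : N) : List N := (T.existsUnique_path i).choose

/-- The number of nodes on the path from the root to `i`. -/
def depth (i : N) : ℕ := (T.path i).length

/-- The node `i` is an ancestor of `j`, or equal to it. -/
def Anc (i j : N) : Prop := Relation.ReflTransGen T.E i j

variable {T}

theorem path_spec (i : N) :
    (T.path i).IsChain T.E ∧ (T.path i).head? = some T.root ∧ (T.path i).getLast? = some i :=
  (T.existsUnique_path i).choose_spec.1

theorem path_unique {i : N} {p : List N} (h : p.IsChain T.E) (hh : p.head? = some T.root)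
    (hl : p.getLast? = some i) : p = T.path i :=
  (T.existsUnique_path i).unique ⟨h, hh, hl⟩ (path_spec i)

/-- This is where uniqueness of root paths enters; depth, unique parents and the absence of cycles
all follow from it. -/
theorem path_child {i j : N} (h : T.E i j) : T.path j = T.path i ++ [j] := by
  obtain ⟨h1, h2, h3⟩ := T.path_spec i
  refine (path_unique ?_ ?_ (by simp)).symm
  · refine h1.append (List.isChain_singleton j) fun x hx y hy => ?_
    rw [h3] at hx
    simp only [List.head?_cons, Option.mem_def, Option.some.injEq] at hx hy
    rwa [← hx, ← hy]
  · rw [List.head?_append, h2]; rfl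

theorem depth_child {i j : N} (h : T.E i j) : T.depth j = T.depth i + 1 := by
  simp [depth, path_child h]

theorem parent_unique {i i' j : N} (h : T.E i j) (h' : T.E i' j) : i = i' := by
  have h1 := (path_child h).symm.trans (path_child h')
  have h2 : T.path i = T.path i' := List.append_cancel_right h1
  have h3 := (T.path_spec i).2.2
  rw [h2, (T.path_spec i').2.2] at h3
  exact (Option.some.inj h3).symm

theorem not_edge_root (i : N) : ¬ T.E i T.root := by
  intro h
  have h1 : [T.root] = T.path T.root := path_unique (List.isChain_singleton _) rfl rfl
  have h2 := (T.path_spec i).2.1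
  rw [path_child h] at h1
  have h3 : T.path i = [] := by
    have := congrArg List.length h1
    simpa using this
  simp [h3] at h2

theorem exists_parent {j : N} (hj : j ≠ T.root) : ∃ i, T.E i j := by
  obtain ⟨h1, h2, h3⟩ := T.path_spec j
  obtain ⟨l, hl⟩ := List.getLast?_eq_some_iff.1 h3
  rw [hl] at h1 h2
  rcases List.eq_nil_or_concat l with rfl | ⟨l', i, rfl⟩
  · simp at h2; exact absurd h2 hj
  · refine ⟨i, ?_⟩
    rw [List.isChain_append] at h1
    exact h1.2.2 i (by simp) j (by simp)

theorem anc_root (j : N) : T.Anc T.root j := by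
  induction h : T.depth j using Nat.strong_induction_on generalizing j with
  | _ n ih =>
    by_cases hj : j = T.root
    · subst hj; exact .refl
    · obtain ⟨i, hi⟩ := exists_parent hj
      exact (ih (T.depth i) (by rw [← h, depth_child hi]; omega) i rfl).tail hi

theorem Anc.refl (i : N) : T.Anc i i := Relation.ReflTransGen.refl

theorem Anc.trans {a b c : N} (h : T.Anc a b) (h' : T.Anc b c) : T.Anc a c :=
  Relation.ReflTransGen.trans h h'

theorem Anc.child {a i j : N} (h : T.Anc a i) (hij : T.E i j) : T.Anc a j :=
  Relation.ReflTransGen.tail h hij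

theorem Anc.eq_or_parent {a i j : N} (h : T.Anc a j) (hij : T.E i j) : a = j ∨ T.Anc a i := by
  rcases Relation.ReflTransGen.cases_tail h with h | ⟨c, hc, hcj⟩
  · exact .inl h.symm
  · rw [parent_unique hij hcj]; exact .inr hc

theorem Anc.eq_or_child {a j : N} (h : T.Anc a j) : a = j ∨ ∃ c, T.E a c ∧ T.Anc c j :=
  Relation.ReflTransGen.cases_head h

theorem Anc.depth_le {a b : N} (h : T.Anc a b) : T.depth a ≤ T.depth b := by
  induction h with
  | refl => exact le_rfl
  | tail _ h ih => rw [depth_child h]; omega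

theorem Anc.eq_of_depth_le {a b : N} (h : T.Anc a b) (hd : T.depth b ≤ T.depth a) : a = b := by
  rcases h.eq_or_child with h | ⟨c, hc, hcb⟩
  · exact h
  · have := depth_child hc
    have := hcb.depth_le
    omega

theorem edge_ne {i j : N} (h : T.E i j) : i ≠ j := by
  rintro rfl
  have := depth_child h
  omega

theorem Anc.total {a b j : N} (ha : T.Anc a j) (hb : T.Anc b j) : T.Anc a b ∨ T.Anc b a := by
  induction ha with
  | refl => exact .inr hb
  | tail hac hcj ih =>
    rcases hb.eq_or_parent hcj with rfl | h
    · exact .inl (Anc.child hac hcj)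
    · exact ih h

theorem finite_setOf_anc (j : N) : {a | T.Anc a j}.Finite := by
  have h : T.Anc T.root j := anc_root j
  induction h with
  | refl =>
    refine (Set.finite_singleton T.root).subset fun a ha => ?_
    exact (Anc.eq_of_depth_le ha (anc_root a).depth_le)
  | @tail b c _ hbc ih =>
    refine (ih.insert c).subset fun a ha => ?_
    rcases Anc.eq_or_parent ha hbc with h | h
    · exact .inl h
    · exact .inr h

/-- Every walk that leaves the descendants of `j` runs through `j` and its parent. -/
theorem mem_support_of_walk {i j : N} (hij : T.E i j) {a b : N} (w : T.graph.Walk a b)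
    (ha : T.Anc j a) (hb : ¬ T.Anc j b) : i ∈ w.support ∧ j ∈ w.support := by
  induction w with
  | nil => exact absurd ha hb
  | @cons a c b hac w ih =>
    by_cases hc : T.Anc j c
    · have := ih hc hb
      simp [this.1, this.2]
    · rw [graph, SimpleGraph.fromRel_adj] at hac
      rcases hac.2 with h | h
      · exact absurd (ha.child h) hc
      · rcases ha.eq_or_parent h with rfl | h'
        · rw [parent_unique hij h]
          simp
        · exact absurd h' hc

theorem separates_of_child {i j : N} (hij : T.E i j) {B : Finset N} (hi : i ∉ B)
    (hB : ∀ b ∈ B, ¬ T.Anc j b) : T.Separates i {j} B := by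
  intro a ha b hb
  rw [Finset.mem_singleton] at ha
  subst ha
  exact ⟨edge_ne hij, fun h => hi (h ▸ hb),
    fun w _ => (mem_support_of_walk hij w (.refl _) (hB b hb)).1⟩

/-- A walk from `i` to a descendant of `j`, read backwards, leaves the descendants of `j` and so
meets `j`. -/
theorem separates_of_parent {i j : N} (hij : T.E i j) {B : Finset N} (hj : j ∉ B)
    (hB : ∀ b ∈ B, T.Anc j b) : T.Separates j {i} B := by
  intro a ha b hb
  rw [Finset.mem_singleton] at ha
  subst ha
  refine ⟨(edge_ne hij).symm, fun h => hj (h ▸ hb), fun w _ => ?_⟩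
  have h : ¬ T.Anc j a := fun h => by
    have := h.depth_le
    have := depth_child hij
    omega
  simpa using (mem_support_of_walk hij w.reverse (hB b hb) h).2

theorem IsRootPath.root_notMem {P : Set N} (hP : T.IsRootPath P) : T.root ∉ P := by
  rcases hP with ⟨l, k, _, hl, _, rfl⟩ | ⟨l, h0, hl, rfl⟩
  · intro h
    have h1 : (T.root :: l).IsChain (fun a b => T.depth a < T.depth b) :=
      hl.imp fun a b hab => by rw [depth_child hab]; omega
    have : IsTrans N (fun a b => T.depth a < T.depth b) := ⟨fun a b c hab hbc => lt_trans hab hbc⟩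
    have h2 := List.isChain_iff_pairwise.1 h1
    exact lt_irrefl _ ((List.pairwise_cons.1 h2).1 _ h)
  · rintro ⟨n, hn⟩
    cases n with
    | zero => exact not_edge_root T.root (hn ▸ h0)
    | succ n => exact not_edge_root (l n) (hn ▸ hl n)

theorem IsRootPath.total {P : Set N} (hP : T.IsRootPath P) {p q : N} (hp : p ∈ P) (hq : q ∈ P) :
    T.Anc p q ∨ T.Anc q p := by
  rcases hP with ⟨l, k, _, hl, _, rfl⟩ | ⟨l, h0, hl, rfl⟩
  · have h1 : (T.root :: l).IsChain T.Anc := hl.imp fun a b hab => (Anc.refl a).child hab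
    have : IsTrans N T.Anc := ⟨fun a b c hab hbc => hab.trans hbc⟩
    have h2 := (List.pairwise_cons.1 (List.isChain_iff_pairwise.1 h1)).2
    have h3 : l.Pairwise fun a b => T.Anc a b ∨ T.Anc b a := h2.imp fun h => .inl h
    have : Std.Symm fun a b => T.Anc a b ∨ T.Anc b a := ⟨fun a b h => h.symm⟩
    exact List.Pairwise.forall_of_forall (R := fun a b => T.Anc a b ∨ T.Anc b a)
      (fun a _ => Or.inl (Anc.refl a)) h3 hp hq
  · obtain ⟨n, rfl⟩ := hp
    obtain ⟨m, rfl⟩ := hq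
    have key : ∀ n m, n ≤ m → T.Anc (l n) (l m) := by
      intro n m hnm
      induction m, hnm using Nat.le_induction with
      | base => exact .refl _
      | succ m _ ih => exact ih.child (hl m)
    rcases le_total n m with h | h
    · exact .inl (key n m h)
    · exact .inr (key m n h)

/-- Parent and child are two distinct neighbours, since their depths differ. This makes the
parent-given-child assumption available at every node that has a child. -/
theorem notMem_leaves {i j c : N} (hij : T.E i j) (hjc : T.E j c) : j ∉ T.leaves := by
  rintro ⟨-, h⟩
  have h1 := Set.encard_le_one_iff.1 (le_of_eq h) i c (.inr hij) (.inl hjc)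
  have := depth_child hij
  have := depth_child hjc
  rw [h1] at *
  omega

theorem eq_of_edge_root {k c : N} (hk : T.E T.root k) (hdeg : ¬ 2 ≤ T.deg T.root)
    (hc : T.E T.root c) : c = k := by
  by_contra hne
  refine hdeg ?_
  rw [deg, ← Set.encard_pair hne]
  refine Set.encard_le_encard ?_
  rintro x (rfl | rfl)
  · exact .inl hc
  · exact .inl hk

/-- Sets of nodes that are closed under taking parents. -/
def ParentClosed (T : DirTree N) (S : Finset N) : Prop := ∀ i j, T.E i j → j ∈ S → i ∈ S

theorem ParentClosed.anc {S : Finset N} (hS : T.ParentClosed S) {a b : N} (h : T.Anc a b)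
    (hb : b ∈ S) : a ∈ S := by
  induction h with
  | refl => exact hb
  | tail _ h ih => exact ih (hS _ _ h hb)

theorem ParentClosed.erase [DecidableEq N] {S : Finset N} (hS : T.ParentClosed S) {j : N}
    (hj : ∀ c, T.E j c → c ∉ S) : T.ParentClosed (S.erase j) := by
  intro a b hab hb
  rw [Finset.mem_erase] at hb ⊢
  exact ⟨fun h => hj b (h ▸ hab) hb.2, hS a b hab hb.2⟩

theorem exists_parentClosed (F : Finset N) : ∃ S : Finset N, F ⊆ S ∧ T.ParentClosed S := by
  have hfin : (⋃ j ∈ F, {a | T.Anc a j}).Finite :=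
    F.finite_toSet.biUnion fun j _ => finite_setOf_anc j
  refine ⟨hfin.toFinset, fun j hj => ?_, fun i j hij hj => ?_⟩
  · simp only [Set.Finite.mem_toFinset, Set.mem_iUnion]
    exact ⟨j, hj, Anc.refl j⟩
  · simp only [Set.Finite.mem_toFinset, Set.mem_iUnion] at hj ⊢
    obtain ⟨n, hn, h⟩ := hj
    exact ⟨n, hn, ((Anc.refl i).child hij).trans h⟩

/-- A finite subtree with a node other than the root and its child `k` has a further leaf that is
below all nodes of the root path `P`. -/
theorem exists_leaf_below_rootPath {P : Set N} (hP : T.IsRootPath P) {k : N} (hk : T.E T.root k)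
    (hkP : 2 ≤ T.deg T.root → k ∉ P) {S : Finset N} (hS : T.ParentClosed S)
    (hne : ∃ q ∈ S, q ≠ T.root ∧ q ≠ k) :
    ∃ j ∈ S, j ≠ T.root ∧ j ≠ k ∧ (∀ c, T.E j c → c ∉ S) ∧ ∀ p ∈ P, p ∈ S → T.Anc p j := by
  classical
  by_cases hPS : ∃ p ∈ S, p ∈ P
  · obtain ⟨p, hp, hpmax⟩ := (S.filter (· ∈ P)).exists_max_image T.depth
      (by obtain ⟨p, h1, h2⟩ := hPS; exact ⟨p, by simp [h1, h2]⟩)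
    rw [Finset.mem_filter] at hp
    -- `p` is the deepest node of `P` in `S`, and `j` a deepest node of `S` below it. As `P` is a
    -- chain, all its nodes in `S` are ancestors of `p`.
    obtain ⟨j, hj, hjmax⟩ := (S.filter (T.Anc p ·)).exists_max_image T.depth
      ⟨p, by simp [hp.1, Anc.refl]⟩
    rw [Finset.mem_filter] at hj
    have hproot : p ≠ T.root := fun h => hP.root_notMem (h ▸ hp.2)
    have hleaf : ∀ c, T.E j c → c ∉ S := fun c hc hcS => by
      have := hjmax c (by simp [hcS, hj.2.child hc])
      rw [depth_child hc] at this
      omega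
    refine ⟨j, hj.1, ?_, ?_, hleaf, ?_⟩
    · rintro rfl
      exact hproot (hj.2.eq_of_depth_le (anc_root p).depth_le)
    -- If `j = k`, then `p = k` lies in `P`, so `k` is the only child of the root. Any further node
    -- of `S` then lies below `k`, which is impossible for a leaf of `S`.
    · rintro rfl
      have hpk : p = j := by
        rcases hj.2.eq_or_parent hk with h | h
        · exact h
        · exact absurd (h.eq_of_depth_le (anc_root p).depth_le) hproot
      subst hpk
      have hdeg : ¬ 2 ≤ T.deg T.root := fun h => hkP h hp.2
      obtain ⟨q, hqS, hq0, hqk⟩ := hne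
      rcases (anc_root q).eq_or_child with h | ⟨c, hc, hcq⟩
      · exact hq0 h.symm
      · rw [eq_of_edge_root hk hdeg hc] at hcq
        rcases hcq.eq_or_child with h | ⟨d, hd, hdq⟩
        · exact hqk h.symm
        · exact hleaf d hd (hS.anc hdq hqS)
    · intro q hqP hqS
      refine Anc.trans ?_ hj.2
      rcases hP.total hqP hp.2 with h | h
      · exact h
      · rw [h.eq_of_depth_le (hpmax q (by simp [hqP, hqS]))]
        exact .refl _
  · obtain ⟨j, hj, hjmax⟩ := (S.filter fun q => q ≠ T.root ∧ q ≠ k).exists_max_image T.depth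
      (by obtain ⟨q, h1, h2⟩ := hne; exact ⟨q, by simp [h1, h2]⟩)
    rw [Finset.mem_filter] at hj
    refine ⟨j, hj.1, hj.2.1, hj.2.2, fun c hc hcS => ?_, fun p hpP hpS => absurd ⟨p, hpS, hpP⟩ hPS⟩
    have := hjmax c (by
      rw [Finset.mem_filter]
      refine ⟨hcS, ?_, ?_⟩
      · rintro rfl; exact not_edge_root _ hc
      · rintro rfl; exact hj.2.1 (parent_unique hc hk))
    rw [depth_child hc] at this
    omega

end DirTree

/-! ### Comparison of bounded supermodular functionals of Markov trees -/

section Reduction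

variable {N : Type*} [DecidableEq N]

/-- Up to an arbitrarily small error, a bounded supermodular function `f` of the coordinates in `S`
may be replaced by one of the coordinates `i` and `j` only, both under `Q` and after resampling the
coordinate `j` given the coordinate `i` by `κ`. -/
def Reduces (Q : Measure (N → ℝ)) (κ : Kernel ℝ ℝ) (i j : N) (S : Finset N) : Prop :=
  ∀ (M : ℝ) (f : (N → ℝ) → ℝ), BddMeasOn M (S : Set N) f → Supermodular f → ∀ ε > 0,
    ∃ g : (N → ℝ) → ℝ, BddMeasOn M {i, j} g ∧ Supermodular g ∧
      |∫ x, f x ∂Q - ∫ x, g x ∂Q| ≤ ε ∧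
      |∫ x, resample κ i j f x ∂Q - ∫ x, resample κ i j g x ∂Q| ≤ ε

variable {Q : Measure (N → ℝ)} {κ : Kernel ℝ ℝ} {i j : N} {S : Finset N}

theorem reduces_of_subset_pair (h : ∀ q ∈ S, q = i ∨ q = j) : Reduces Q κ i j S := by
  intro M f hf hs ε hε
  exact ⟨f, hf.mono fun q hq => h q hq, hs, by simpa using hε.le, by simpa using hε.le⟩

/-- Resampling by a monotone approximation of the conditional distribution. -/
theorem exists_supermodular_resample [Countable N] {T : DirTree N} [IsProbabilityMeasure Q]
    (hQ : T.IsMarkov Q) {l l' : N} (hll : l' ≠ l)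
    (hsep : T.Separates l' {l} ((S.erase l).erase l'))
    (hsi : StochIncr Q (fun x => x l) (fun x => x l')) {ε : ℝ} (hε : 0 < ε) (M : ℝ) :
    ∃ κ' : Kernel ℝ ℝ, IsMarkovKernel κ' ∧ MonoKernel κ' ∧
      ∀ f, BddMeasOn M (S : Set N) f →
        |∫ x, f x ∂Q - ∫ x, resample κ' l' l f x ∂Q| ≤ ε := by
  -- The error is at most `2 * M * δ ≤ ε`. It depends on `M` only, so one `κ'` serves every function
  -- with this bound, in particular both `f` and its resampled version.
  have hδ : 0 < ε / (2 * (|M| + 1)) := by positivity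
  obtain ⟨κ', h1, h2, A, hA, hAε, hκ'⟩ := hsi.exists_monoKernel (measurable_pi_apply l') hδ
  refine ⟨κ', h1, h2, fun f hf => ?_⟩
  have hM : 0 ≤ M := (abs_nonneg _).trans (hf.bound 0)
  rw [← hQ.integral_resample hll hsep hf]
  refine (abs_integral_resample_sub_le hf _ κ' hA hAε hκ').trans ?_
  rw [abs_of_nonneg hM, ← mul_div_assoc, div_le_iff₀ (by positivity)]
  nlinarith

/-- Coordinate `l` is integrated out given `l'`. This commutes with resampling `j` given `i`, so the
same reduced function serves both estimates in `Reduces`. -/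
theorem Reduces.of_erase [Countable N] {T : DirTree N} [IsProbabilityMeasure Q] [IsMarkovKernel κ]
    (hQ : T.IsMarkov Q) {l l' : N} (hll : l' ≠ l) (hl' : l' ∈ S) (hi : i ∈ S) (hli : l ≠ i)
    (hlj : l ≠ j) (hlj' : l' ≠ j) (hsep : T.Separates l' {l} ((S.erase l).erase l'))
    (hsi : StochIncr Q (fun x => x l) (fun x => x l')) (h : Reduces Q κ i j (S.erase l)) :
    Reduces Q κ i j S := by
  intro M f hf hs ε hε
  obtain ⟨κ', _, hmono, hκ'⟩ := exists_supermodular_resample hQ hll hsep hsi (half_pos hε) M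
  have hf' : BddMeasOn M (S.erase l : Set N) (resample κ' l' l f) := by
    refine (hf.resample κ' l' l).mono ?_
    rintro q (rfl | ⟨hq, hql⟩)
    · simp [hll, hl']
    · simpa using ⟨hq, hql⟩
  obtain ⟨g, hg, hgs, h1, h2⟩ := h M _ hf' (hs.resample hmono hf l' l) _ (half_pos hε)
  refine ⟨g, hg, hgs, ?_, ?_⟩
  · have h3 := hκ' f hf
    have := abs_sub_le (∫ x, f x ∂Q) (∫ x, resample κ' l' l f x ∂Q) (∫ x, g x ∂Q)
    linarith
  · have hfj : BddMeasOn M (S : Set N) (resample κ i j f) := by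
      refine (hf.resample κ i j).mono ?_
      rintro q (rfl | ⟨hq, -⟩)
      · exact hi
      · exact hq
    have h3 := hκ' _ hfj
    rw [resample_comm hf κ' κ hlj hlj' hli.symm] at h3
    have := abs_sub_le (∫ x, resample κ i j f x ∂Q)
      (∫ x, resample κ i j (resample κ' l' l f) x ∂Q) (∫ x, resample κ i j g x ∂Q)
    linarith

variable [Countable N] {T : DirTree N} [IsProbabilityMeasure Q] [IsMarkovKernel κ]

open DirTree

/-- The ancestors of `i` are removed from the top, each resampled given its child. In `hup` the
third node `c` encodes that `b` is not a leaf. -/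
theorem reduces_of_anc (hQ : T.IsMarkov Q) (hij : T.E i j)
    (hup : ∀ a b c, T.E a b → T.E b c → StochIncr Q (fun x => x a) (fun x => x b))
    (hi : i ∈ S) (hS : ∀ q ∈ S, T.Anc q i ∨ q = j)
    (hclosed : ∀ q ∈ S, ∀ c, T.E q c → T.Anc c i → c ∈ S) : Reduces Q κ i j S := by
  induction hn : S.card using Nat.strong_induction_on generalizing S with
  | _ n ih =>
  by_cases hall : ∀ q ∈ S, q = i ∨ q = j
  · exact reduces_of_subset_pair hall
  push Not at hall
  -- `l` is the topmost remaining node and `l'` its child towards `i`; everything else in `S` lies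
  -- at or below `l'`, which therefore separates `l` from it.
  obtain ⟨l, hl, hmin⟩ := (S.filter fun q => q ≠ i ∧ q ≠ j).exists_min_image T.depth
    (by obtain ⟨q, h1, h2⟩ := hall; exact ⟨q, by simp [h1, h2]⟩)
  rw [Finset.mem_filter] at hl
  obtain ⟨hlS, hli, hlj⟩ := hl
  have hlanc : T.Anc l i := (hS l hlS).resolve_right hlj
  obtain ⟨l', hll', hl'i⟩ := hlanc.eq_or_child.resolve_left hli
  have hl'S : l' ∈ S := hclosed l hlS l' hll' hl'i
  have hl'j : l' ≠ j := by
    rintro rfl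
    have := hl'i.depth_le
    have := depth_child hij
    omega
  have hqmin : ∀ q ∈ S, q ≠ l → T.Anc l' q := by
    intro q hq hql
    by_cases hqj : q = j
    · rw [hqj]; exact hl'i.child hij
    have hqi := (hS q hq).resolve_right hqj
    rcases hl'i.total hqi with h | h
    · exact h
    · rcases h.eq_or_parent hll' with h | h
      · rw [h]; exact .refl _
      · refine absurd (h.eq_of_depth_le (hmin q ?_)) hql
        rw [Finset.mem_filter]
        refine ⟨hq, ?_, hqj⟩
        rintro rfl
        exact hli (hlanc.eq_of_depth_le h.depth_le)
  have hsep : T.Separates l' {l} ((S.erase l).erase l') :=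
    separates_of_parent hll' (by simp) fun b hb => by
      simp only [Finset.mem_erase] at hb
      exact hqmin b hb.2.2 hb.2.1
  have hsi : StochIncr Q (fun x => x l) (fun x => x l') := by
    -- Either way `l'` has a child, namely `j` or the next node towards `i`.
    rcases hl'i.eq_or_child with h | ⟨c, hc, -⟩
    · exact hup l l' j hll' (h ▸ hij)
    · exact hup l l' c hll' hc
  refine Reduces.of_erase hQ (edge_ne hll').symm hl'S hi hli hlj hl'j hsep hsi
    (ih (S.erase l).card ?_ ?_ ?_ ?_ rfl)
  · rw [← hn]; exact Finset.card_erase_lt_of_mem hlS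
  · exact Finset.mem_erase.2 ⟨hli.symm, hi⟩
  · exact fun q hq => hS q (Finset.mem_of_mem_erase hq)
  · intro q hq c hqc hci
    rw [Finset.mem_erase] at hq ⊢
    refine ⟨?_, hclosed q hq.2 c hqc hci⟩
    rintro rfl
    have := (hqmin q hq.2 hq.1).depth_le
    have := depth_child hll'
    have := depth_child hqc
    omega

/-- The nodes that are not ancestors of `j` are removed from the bottom, each resampled given its
parent. The line of ancestors that remains is left to `reduces_of_anc`. The conditional laws across
the edge from `i` to `j` are never used. -/
theorem reduces_of_parentClosed (hQ : T.IsMarkov Q) (hij : T.E i j)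
    (hup : ∀ a b c, T.E a b → T.E b c → StochIncr Q (fun x => x a) (fun x => x b))
    (hS : T.ParentClosed S) (hj : j ∈ S) (hleaf : ∀ c, T.E j c → c ∉ S)
    (hdown : ∀ a, ∀ b ∈ S, T.E a b → ¬ T.Anc b j → StochIncr Q (fun x => x b) (fun x => x a)) :
    Reduces Q κ i j S := by
  classical
  induction hn : S.card using Nat.strong_induction_on generalizing S with
  | _ n ih =>
  have hi : i ∈ S := hS i j hij hj
  by_cases hall : ∀ q ∈ S, T.Anc q i ∨ q = j
  · exact reduces_of_anc hQ hij hup hi hall fun q _ c _ hci => hS.anc hci hi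
  push Not at hall
  obtain ⟨l, hl, hmax⟩ := (S.filter fun q => ¬ T.Anc q i ∧ q ≠ j).exists_max_image T.depth
    (by obtain ⟨q, h1, h2⟩ := hall; exact ⟨q, by simp [h1, h2]⟩)
  rw [Finset.mem_filter] at hl
  obtain ⟨hlS, hli, hlj⟩ := hl
  have hlroot : l ≠ T.root := by
    rintro rfl
    exact hli (anc_root i)
  obtain ⟨l', hl'l⟩ := exists_parent hlroot
  have hleaf' : ∀ c, T.E l c → c ∉ S := by
    intro c hc hcS
    have h1 : ¬ T.Anc c i := fun h => hli (((Anc.refl l).child hc).trans h)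
    have h2 : c ≠ j := by
      rintro rfl
      exact hli (parent_unique hc hij ▸ .refl _)
    have := hmax c (by simp [hcS, h1, h2])
    rw [depth_child hc] at this
    omega
  have hlj' : ¬ T.Anc l j := fun h => (h.eq_or_parent hij).elim hlj hli
  have hsep : T.Separates l' {l} ((S.erase l).erase l') :=
    separates_of_child hl'l (by simp) fun b hb h => by
      simp only [Finset.mem_erase] at hb
      rcases h.eq_or_child with h | ⟨c, hc, hcb⟩
      · exact hb.2.1 h.symm
      · exact hleaf' c hc (hS.anc hcb hb.2.2)
  have hli' : l ≠ i := by
    rintro rfl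
    exact hli (.refl _)
  have hl'j : l' ≠ j := by
    rintro rfl
    exact hleaf l hl'l hlS
  refine Reduces.of_erase hQ (edge_ne hl'l) (hS _ _ hl'l hlS) hi hli' hlj hl'j hsep
    (hdown l' l hlS hl'l hlj') (ih (S.erase l).card ?_ (hS.erase hleaf') ?_ ?_ ?_ rfl)
  · rw [← hn]; exact Finset.card_erase_lt_of_mem hlS
  · exact Finset.mem_erase.2 ⟨hlj.symm, hj⟩
  · exact fun c hc h => hleaf c hc (Finset.mem_of_mem_erase h)
  · exact fun a b hb => hdown a b (Finset.mem_of_mem_erase hb)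

end Reduction

section Comparison

variable {N : Type*} {P Q : Measure (N → ℝ)} {σ : ℝ}

/-- Comparable pairs have the same marginal distributions. -/
theorem integral_eq_of_pair_comparison {i j : N} (hσ : σ ≠ 0)
    (hpair : ∀ M g, BddMeasOn M {i, j} g → Supermodular g →
      0 ≤ σ * (∫ x, g x ∂Q - ∫ x, g x ∂P))
    {M : ℝ} {h : (N → ℝ) → ℝ} (hh : BddMeasOn M {i} h) : ∫ x, h x ∂Q = ∫ x, h x ∂P := by
  -- A function of one coordinate is modular, so both `h` and `-h` are admissible test functions.
  have hmod : ∀ x y : N → ℝ, h x + h y = h (x ⊓ y) + h (x ⊔ y) := by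
    intro x y
    rcases le_total (x i) (y i) with hxy | hxy
    · have h1 : h (x ⊓ y) = h x := hh.dependsOn fun n hn => by
        rw [Set.mem_singleton_iff.1 hn]; simpa using hxy
      have h2 : h (x ⊔ y) = h y := hh.dependsOn fun n hn => by
        rw [Set.mem_singleton_iff.1 hn]; simpa using hxy
      rw [h1, h2]
    · have h1 : h (x ⊓ y) = h y := hh.dependsOn fun n hn => by
        rw [Set.mem_singleton_iff.1 hn]; simpa using hxy
      have h2 : h (x ⊔ y) = h x := hh.dependsOn fun n hn => by
        rw [Set.mem_singleton_iff.1 hn]; simpa using hxy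
      rw [h1, h2, add_comm]
  have h1 := hpair M h (hh.mono (by simp)) fun x y => (hmod x y).le
  have h2 := hpair M (fun x => - h x)
    ⟨hh.measurable.neg, fun x => by simpa using hh.bound x, fun x y hxy => by
      rw [hh.dependsOn fun n hn => hxy n (by simp at hn; simp [hn])]⟩
    fun x y => by have := hmod x y; linarith
  rw [integral_neg, integral_neg] at h2
  have h3 : σ * (∫ x, h x ∂Q - ∫ x, h x ∂P) = 0 := le_antisymm (by linarith) h1
  have := (mul_eq_zero.1 h3).resolve_left hσ
  linarith

open DirTree

/-- The comparison of bounded supermodular functionals, in both directions according to the sign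
of `σ`. -/
theorem supermodular_comparison [DecidableEq N] [Countable N] [IsProbabilityMeasure P]
    [IsProbabilityMeasure Q] {T : DirTree N} {R : Set N} (hR : T.IsRootPath R)
    {k : N} (hk : T.E T.root k) (hkR : 2 ≤ T.deg T.root → k ∉ R)
    (hP : T.IsMarkov P) (hQ : T.IsMarkov Q) (hσ : σ ≠ 0)
    (hPsi : ∀ i j, T.E i j → j ≠ k → StochIncr P (fun x => x j) (fun x => x i))
    (hQup : ∀ i j, T.E i j → j ∉ T.leaves → StochIncr Q (fun x => x i) (fun x => x j))
    (hQdown : ∀ i j, T.E i j → j ∉ R → StochIncr Q (fun x => x j) (fun x => x i))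
    (hpair : ∀ i j, T.E i j → ∀ M g, BddMeasOn M {i, j} g → Supermodular g →
      0 ≤ σ * (∫ x, g x ∂Q - ∫ x, g x ∂P))
    {S : Finset N} (hS : T.ParentClosed S) (hkS : k ∈ S) {M : ℝ} {f : (N → ℝ) → ℝ}
    (hf : BddMeasOn M (S : Set N) f) (hs : Supermodular f) :
    0 ≤ σ * (∫ x, f x ∂Q - ∫ x, f x ∂P) := by
  induction hn : S.card using Nat.strong_induction_on generalizing S f with
  | _ n ih =>
  -- The node `k` is never removed, because the law of `X_k` given the root need not be increasing;
  -- the pair of root and `k` is the base case.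
  by_cases hall : ∀ q ∈ S, q = T.root ∨ q = k
  · exact hpair T.root k hk M f (hf.mono fun q hq => hall q hq) hs
  push Not at hall
  obtain ⟨j, hjS, hj0, hjk, hleaf, hjR⟩ := exists_leaf_below_rootPath hR hk hkR hS hall
  obtain ⟨i, hij⟩ := exists_parent hj0
  have hi : i ∈ S := hS i j hij hjS
  have hsep : T.Separates i {j} ((S.erase j).erase i) :=
    separates_of_child hij (by simp) fun b hb h => by
      simp only [Finset.mem_erase] at hb
      rcases h.eq_or_child with h | ⟨c, hc, hcb⟩
      · exact hb.2.1 h.symm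
      · exact hleaf c hc (hS.anc hcb hb.2.2)
  set κ := condDistrib (fun x : N → ℝ => x j) (fun x => x i) P with hκ
  -- All nodes of `R` in `S` are ancestors of `j`, so every node removed from the bottom lies off
  -- `R`.
  have hred : Reduces Q κ i j S := by
    refine reduces_of_parentClosed hQ hij
      (fun a b c hab hbc => hQup a b hab (notMem_leaves hab hbc)) hS hjS hleaf
      fun a b hb hab hbj => hQdown a b hab fun hbR => hbj (hjR b hbR hb)
  have hM : 0 ≤ M := (abs_nonneg _).trans (hf.bound 0)
  refine le_of_forall_pos_le_add fun ε hε => ?_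
  -- Four errors of size `δ` occur, `e1` to `e4`, and the total is multiplied by `|σ|`.
  have hδ : 0 < ε / (4 * |σ|) := by positivity
  set δ := ε / (4 * |σ|) with hδdef
  have hmarg : ∀ {M : ℝ} {h : (N → ℝ) → ℝ}, BddMeasOn M {i} h → ∫ x, h x ∂Q = ∫ x, h x ∂P :=
    fun hh => integral_eq_of_pair_comparison hσ (hpair i j hij) hh
  -- Equal marginals at `i` make the set where `κ'` differs from `κ` small under `Q` as well.
  have hmap : P.map (fun x => x i) = Q.map (fun x => x i) := by
    ext A hA
    have hind : Measurable (A.indicator (1 : ℝ → ℝ)) := measurable_one.indicator hA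
    have hint : ∀ ρ : Measure (N → ℝ), ∫ x, A.indicator (1 : ℝ → ℝ) (x i) ∂ρ =
        (ρ.map fun x => x i).real A := fun ρ => by
      rw [← integral_indicator_one hA,
        integral_map (measurable_pi_apply i).aemeasurable hind.aestronglyMeasurable]
    have := hmarg (M := 1) (h := fun x => A.indicator (1 : ℝ → ℝ) (x i))
      ⟨hind.comp (measurable_pi_apply i), fun x => by
        by_cases hx : x i ∈ A <;> simp [hx], fun x y hxy => by simp [hxy i rfl]⟩
    rw [hint, hint] at this
    exact ((measureReal_eq_measureReal_iff (by finiteness) (by finiteness)).1 this).symm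
  have hδ' : 0 < δ / (2 * (M + 1)) := by positivity
  have h2M : 2 * M * (δ / (2 * (M + 1))) ≤ δ := by
    rw [← mul_div_assoc, div_le_iff₀ (by positivity)]
    nlinarith
  obtain ⟨κ', _, hmono, A, hA, hAδ, hκ'⟩ :=
    (hPsi i j hij hjk).exists_monoKernel (measurable_pi_apply i) hδ'
  have e1 := (abs_integral_resample_sub_le (j := j) hf κ κ' hA hAδ hκ').trans h2M
  have e2 := (abs_integral_resample_sub_le (j := j) hf κ κ' hA (hmap ▸ hAδ) hκ').trans h2M
  rw [hκ, hP.integral_resample (edge_ne hij) hsep hf] at e1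
  obtain ⟨g, hg, hgs, e3, e4⟩ := hred M f hf hs δ hδ
  have hf' : BddMeasOn M (S.erase j : Set N) (resample κ' i j f) := by
    refine (hf.resample κ' i j).mono ?_
    rintro q (rfl | ⟨hq, hqj⟩)
    · simp [edge_ne hij, hi]
    · simpa using ⟨hq, hqj⟩
  have c1 := ih (S.erase j).card (by rw [← hn]; exact Finset.card_erase_lt_of_mem hjS)
    (hS.erase hleaf) (Finset.mem_erase.2 ⟨hjk.symm, hkS⟩) hf' (hs.resample hmono hf i j) rfl
  have c2 := hpair i j hij M g hg hgs
  -- The resampled `g` depends on coordinate `i` alone, so `Q` may be replaced by `P`, and under `P`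
  -- resampling by `κ` changes nothing.
  have hgP : ∫ x, resample κ i j g x ∂Q = ∫ x, g x ∂P := by
    rw [hmarg ((hg.resample κ i j).mono ?_)]
    · have hg' : BddMeasOn M (({i, j} : Finset N) : Set N) g := by simpa using hg
      refine hP.integral_resample (edge_ne hij) (fun a _ b hb => ?_) hg'
      simp only [Finset.mem_erase, Finset.mem_insert, Finset.mem_singleton] at hb
      tauto
    · rintro q (rfl | ⟨rfl | rfl, hq⟩)
      · rfl
      · rfl
      · exact absurd rfl hq
  rw [hgP] at e4
  have etot : |(∫ x, f x ∂Q - ∫ x, f x ∂P) -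
      ((∫ x, resample κ' i j f x ∂Q - ∫ x, resample κ' i j f x ∂P) +
        (∫ x, g x ∂Q - ∫ x, g x ∂P))| ≤ 4 * δ := by
    rw [abs_le] at *
    constructor <;> linarith [e1.1, e1.2, e2.1, e2.2, e3.1, e3.2, e4.1, e4.2]
  have hσε : |σ| * (4 * δ) = ε := by
    rw [hδdef]; field_simp
  have h5 := mul_le_mul_of_nonneg_left etot (abs_nonneg σ)
  rw [← abs_mul, hσε, mul_sub, mul_add] at h5
  linarith [(abs_le.1 h5).1]

end Comparison

/-! ### Reduction of the supermodular order to bounded functions -/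

theorem Supermodular.comp {ι κ : Type*} {f : (ι → ℝ) → ℝ} (hf : Supermodular f)
    {φ : (κ → ℝ) → ι → ℝ} (hinf : ∀ x y, φ (x ⊓ y) = φ x ⊓ φ y)
    (hsup : ∀ x y, φ (x ⊔ y) = φ x ⊔ φ y) : Supermodular fun x => f (φ x) := by
  intro x y
  simp only [hinf, hsup]
  exact hf _ _

/-- Componentwise truncation to `[-c, c]`. -/
def truncate {ι : Type*} (c : ℝ) (x : ι → ℝ) : ι → ℝ := fun i => max (-c) (min c (x i))

/-- Componentwise truncation is a lattice homomorphism, so it preserves supermodularity. It moves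
points towards `0`, so `C * b` dominates the truncated functions and dominated convergence applies.
-/
theorem smLE_of_bounded {ι : Type*} [Finite ι] {P Q : Measure (ι → ℝ)}
    (h : ∀ M f, Measurable f → (∀ x, |f x| ≤ M) → Supermodular f → ∫ x, f x ∂P ≤ ∫ x, f x ∂Q) :
    SmLE P Q := by
  classical
  have := Fintype.ofFinite ι
  rintro b hb hbP hbQ f hf hs ⟨C, hC⟩
  have hC0 : 0 ≤ C := by
    by_contra hC0
    have h1 := (abs_nonneg _).trans (hC 0)
    have h2 := hb.one_le 0
    nlinarith
  have htm : ∀ c : ℝ, Measurable (truncate (ι := ι) c) := fun c =>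
    measurable_pi_lambda _ fun i => measurable_const.max (measurable_const.min (measurable_pi_apply i))
  have htle : ∀ (n : ℕ) (x : ι → ℝ), b (truncate n x) ≤ b x := by
    intro n x
    refine hb.mono _ _ fun i => ?_
    have hn : (0 : ℝ) ≤ n := n.cast_nonneg
    rw [Set.mem_uIcc, truncate]
    rcases le_total 0 (x i) with h0 | h0
    · left
      exact ⟨le_max_of_le_right (le_min hn h0), max_le (by linarith) (min_le_right _ _)⟩
    · right
      exact ⟨le_max_of_le_right (le_min (by linarith) le_rfl),
        max_le (by linarith) (min_le_of_right_le h0)⟩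
  -- On the cube, `b` is at most its value at the corner in the same orthant; the sum over all
  -- corners is a bound independent of `x`.
  have hbdd : ∀ (n : ℕ) (x : ι → ℝ), |f (truncate n x)| ≤
      C * ∑ s : ι → Bool, b fun i => if s i then (n : ℝ) else -n := by
    intro n x
    refine (hC _).trans (mul_le_mul_of_nonneg_left ?_ hC0)
    have hn : (0 : ℝ) ≤ n := n.cast_nonneg
    refine le_trans ?_ (Finset.single_le_sum (f := fun s : ι → Bool =>
      b fun i => if s i then (n : ℝ) else -n) (fun s _ => zero_le_one.trans (hb.one_le _))
      (Finset.mem_univ fun i => decide (0 ≤ x i)))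
    refine hb.mono _ _ fun i => ?_
    rw [Set.mem_uIcc, truncate]
    by_cases h0 : 0 ≤ x i
    · left
      simp only [h0, decide_true, if_true]
      exact ⟨le_max_of_le_right (le_min hn h0), max_le (by linarith) (min_le_left _ _)⟩
    · right
      simp only [h0, decide_false, Bool.false_eq_true, if_false]
      exact ⟨le_max_left _ _, max_le (by linarith) (min_le_of_right_le (not_le.1 h0).le)⟩
  have hlim : ∀ x, Filter.Tendsto (fun n : ℕ => f (truncate n x)) Filter.atTop (nhds (f x)) := by
    intro x
    refine tendsto_const_nhds.congr' ?_
    have : ∀ᶠ n : ℕ in Filter.atTop, ∀ i, |x i| ≤ n :=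
      Filter.eventually_all.2 fun i => Filter.eventually_atTop.2
        ⟨⌈|x i|⌉₊, fun n hn => (Nat.le_ceil _).trans (by exact_mod_cast hn)⟩
    filter_upwards [this] with n hn
    congr 1
    ext i
    have := abs_le.1 (hn i)
    rw [truncate, min_eq_right this.2, max_eq_right this.1]
  have hdom : ∀ ρ : Measure (ι → ℝ), Integrable b ρ →
      Filter.Tendsto (fun n : ℕ => ∫ x, f (truncate n x) ∂ρ) Filter.atTop (nhds (∫ x, f x ∂ρ)) :=
    fun ρ hρ => tendsto_integral_of_dominated_convergence (fun x => C * b x)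
      (fun n => (hf.comp (htm n)).aestronglyMeasurable) (hρ.const_mul C)
      (fun n => ae_of_all _ fun x => (hC _).trans (mul_le_mul_of_nonneg_left (htle n x) hC0))
      (ae_of_all _ hlim)
  refine le_of_tendsto_of_tendsto' (hdom P hbP) (hdom Q hbQ) fun n => ?_
  have hτ : Monotone fun t : ℝ => max (-(n : ℝ)) (min n t) := fun s t hst =>
    max_le_max le_rfl (min_le_min le_rfl hst)
  exact h _ _ (hf.comp (htm n)) (hbdd n)
    (hs.comp (fun x y => funext fun i => hτ.map_inf _ _) fun x y => funext fun i => hτ.map_sup _ _)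

theorem SmLE.integral_le_of_bounded {ι : Type*} [Finite ι] {P Q : Measure (ι → ℝ)}
    [IsFiniteMeasure P] [IsFiniteMeasure Q] (h : SmLE P Q) {M : ℝ} {f : (ι → ℝ) → ℝ}
    (hf : Measurable f) (hM : ∀ x, |f x| ≤ M) (hs : Supermodular f) :
    ∫ x, f x ∂P ≤ ∫ x, f x ∂Q :=
  h (fun _ => 1) ⟨measurable_const, fun _ => le_rfl, fun _ _ _ => le_rfl⟩ (integrable_const _)
    (integrable_const _) f hf hs ⟨M, by simpa using hM⟩

/-! ### Functions of two coordinates -/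

section Pair

variable {N : Type*} [DecidableEq N] {i j : N}

/-- The point with coordinates `v 0` at `i`, `v 1` at `j`, and zero elsewhere. -/
def pairPoint (i j : N) (v : Fin 2 → ℝ) : N → ℝ :=
  fun n => if n = i then v 0 else if n = j then v 1 else 0

theorem measurable_pairPoint : Measurable (pairPoint i j) := by
  refine measurable_pi_lambda _ fun n => ?_
  unfold pairPoint
  split_ifs <;> fun_prop

theorem BddMeasOn.eq_pairPoint {M : ℝ} {g : (N → ℝ) → ℝ} (hg : BddMeasOn M {i, j} g)
    (x : N → ℝ) : g x = g (pairPoint i j ![x i, x j]) := by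
  refine hg.dependsOn fun n hn => ?_
  rcases hn with rfl | hn
  · simp [pairPoint]
  · rw [Set.mem_singleton_iff] at hn
    subst hn
    by_cases h : n = i
    · simp [pairPoint, h]
    · simp [pairPoint, h]

theorem Supermodular.comp_pairPoint {g : (N → ℝ) → ℝ} (hs : Supermodular g) :
    Supermodular fun v => g (pairPoint i j v) := by
  refine hs.comp (fun x y => ?_) fun x y => ?_
  · ext n
    simp only [pairPoint, Pi.inf_apply]
    split_ifs <;> simp
  · ext n
    simp only [pairPoint, Pi.sup_apply]
    split_ifs <;> simp

theorem integral_le_of_smLE_pair {P Q : Measure (N → ℝ)} [IsFiniteMeasure P] [IsFiniteMeasure Q]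
    (h : SmLE (P.map fun x => ![x i, x j]) (Q.map fun x => ![x i, x j])) {M : ℝ}
    {g : (N → ℝ) → ℝ} (hg : BddMeasOn M {i, j} g) (hs : Supermodular g) :
    ∫ x, g x ∂P ≤ ∫ x, g x ∂Q := by
  have hm : Measurable fun v => g (pairPoint i j v) := hg.measurable.comp measurable_pairPoint
  have hv : Measurable fun x : N → ℝ => ![x i, x j] := by
    refine measurable_pi_lambda _ fun k => ?_
    fin_cases k
    · exact measurable_pi_apply i
    · exact measurable_pi_apply j
  have := h.integral_le_of_bounded hm (fun v => hg.bound _) hs.comp_pairPoint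
  rw [integral_map hv.aemeasurable hm.aestronglyMeasurable,
    integral_map hv.aemeasurable hm.aestronglyMeasurable] at this
  simpa only [← hg.eq_pairPoint] using this

end Pair

theorem procSmLE_of_bounded {N : Type*} {P Q : Measure (N → ℝ)}
    (h : ∀ (F : Finset N) M f, BddMeasOn M (F : Set N) f → Supermodular f →
      ∫ x, f x ∂P ≤ ∫ x, f x ∂Q) : ProcSmLE P Q := by
  classical
  intro m n
  refine smLE_of_bounded fun M f hf hM hs => ?_
  have hn : Measurable fun (x : N → ℝ) (k : Fin m) => x (n k) :=
    measurable_pi_lambda _ fun k => measurable_pi_apply _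
  rw [integral_map hn.aemeasurable hf.aestronglyMeasurable,
    integral_map hn.aemeasurable hf.aestronglyMeasurable]
  refine h (Finset.univ.image n) M _ ⟨hf.comp hn, fun x => hM _, fun x y hxy => ?_⟩
    (hs.comp (fun x y => rfl) fun x y => rfl)
  congr 1
  ext k
  exact hxy _ (by simp)

/-! ### Independent families -/

theorem condDistrib_ae_eq_const_of_indepFun {Ω β γ : Type*} [MeasurableSpace Ω]
    [MeasurableSpace β] [MeasurableSpace γ] [StandardBorelSpace γ] [Nonempty γ] {μ : Measure Ω}
    [IsProbabilityMeasure μ] {U : Ω → β} {V : Ω → γ} (hU : Measurable U) (hV : Measurable V)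
    (h : IndepFun U V μ) : condDistrib V U μ =ᵐ[μ.map U] Kernel.const β (μ.map V) := by
  have : IsProbabilityMeasure (μ.map V) := Measure.isProbabilityMeasure_map hV.aemeasurable
  have : IsProbabilityMeasure (μ.map U) := Measure.isProbabilityMeasure_map hU.aemeasurable
  refine condDistrib_ae_eq_of_measure_eq_compProd U hV.aemeasurable ?_
  rw [Measure.compProd_const]
  exact (indepFun_iff_map_prod_eq_prod_map_map hU.aemeasurable hV.aemeasurable).1 h

theorem stochIncr_of_indepFun {Ω : Type*} [MeasurableSpace Ω] {μ : Measure Ω}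
    [IsProbabilityMeasure μ] {U V : Ω → ℝ} (hU : Measurable U) (hV : Measurable V)
    (h : IndepFun U V μ) : StochIncr μ V U := by
  refine ⟨{u | ¬ condDistrib V U μ u = μ.map V}, ?_, fun u hu u' hu' _ f _ _ _ => ?_⟩
  · filter_upwards [condDistrib_ae_eq_const_of_indepFun hU hV h] with u hu
    exact hu
  · simp only [Set.mem_ofPred_eq, not_not] at hu hu'
    rw [hu, hu']

/-- Given `(x_i, x_A)` or given `x_i` alone, the conditional law of `x_B` is its marginal law. If
`A` or `B` is empty, separation says nothing about `i`, so these cases are treated apart. -/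
theorem isMarkov_of_iIndepFun {N : Type*} [Countable N] (T : DirTree N) {P : Measure (N → ℝ)}
    [IsProbabilityMeasure P] (h : iIndepFun (fun n (x : N → ℝ) => x n) P) : T.IsMarkov P := by
  classical
  intro A B i hAB hsep
  rcases A.eq_empty_or_nonempty with rfl | ⟨a, ha⟩
  · have : (fun (x : N → ℝ) (j : (∅ : Finset N)) => x j) = fun _ => fun _ => 0 := by
      ext x j; exact absurd j.2 (Finset.notMem_empty _)
    rw [this]
    exact condIndepFun_const_left _ _
  rcases B.eq_empty_or_nonempty with rfl | ⟨b, hb⟩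
  · have : (fun (x : N → ℝ) (j : (∅ : Finset N)) => x j) = fun _ => fun _ => 0 := by
      ext x j; exact absurd j.2 (Finset.notMem_empty _)
    rw [this]
    exact condIndepFun_const_right _ _
  have hiB : i ∉ B := fun hi => (hsep a ha i hi).2.1 rfl
  have hm : ∀ n, Measurable fun x : N → ℝ => x n := fun n => measurable_pi_apply n
  have hf : Measurable fun (x : N → ℝ) (j : B) => x j := measurable_pi_lambda _ fun j => hm j
  have hg : Measurable fun (x : N → ℝ) (j : A) => x j := measurable_pi_lambda _ fun j => hm j
  have hind := h.indepFun_finset (insert i A) B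
    (by rw [Finset.disjoint_insert_left]; exact ⟨hiB, hAB⟩) hm
  have hφ : Measurable fun v : ↥(insert i A) → ℝ =>
      (v ⟨i, Finset.mem_insert_self i A⟩, fun j : A => v ⟨j, Finset.mem_insert_of_mem j.2⟩) := by
    fun_prop
  have hind1 : IndepFun (fun x : N → ℝ => (x i, fun j : A => x j)) (fun x (j : B) => x j) P :=
    hind.comp hφ measurable_id
  have hind2 : IndepFun (fun x : N → ℝ => x i) (fun x (j : B) => x j) P :=
    hind1.comp measurable_fst measurable_id
  refine (condIndepFun_iff_condDistrib_prod_ae_eq_prodMkRight hf hg (hm i)).2 ?_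
  have h1 := condDistrib_ae_eq_const_of_indepFun ((hm i).prodMk hg) hf hind1
  have h2 := condDistrib_ae_eq_const_of_indepFun (hm i) hf hind2
  have h3 : (P.map fun x : N → ℝ => (x i, fun j : A => x j)).map Prod.fst =
      P.map fun x => x i := by
    rw [Measure.map_map measurable_fst ((hm i).prodMk hg)]; rfl
  rw [← h3] at h2
  filter_upwards [h1, ae_of_ae_map measurable_fst.aemeasurable h2] with p hp1 hp2
  rw [hp1, Kernel.prodMkRight_apply, hp2]
  rfl

/-- Stochastic monotonicity implies positive supermodular dependence of a pair. -/
theorem integral_infinitePi_le_of_stochIncr {N : Type*} [Countable N] [DecidableEq N]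
    {T : DirTree N} {P : Measure (N → ℝ)} [IsProbabilityMeasure P] (hP : T.IsMarkov P) {i j : N}
    (hij : i ≠ j) (hsi : StochIncr P (fun x => x j) (fun x => x i)) {M : ℝ} {g : (N → ℝ) → ℝ}
    (hg : BddMeasOn M {i, j} g) (hs : Supermodular g) :
    ∫ x, g x ∂(Measure.infinitePi fun n => P.map fun x => x n) ≤ ∫ x, g x ∂P := by
  have hm : ∀ n, Measurable fun x : N → ℝ => x n := fun n => measurable_pi_apply n
  have hprob : ∀ n, IsProbabilityMeasure (P.map fun x : N → ℝ => x n) := fun n =>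
    Measure.isProbabilityMeasure_map (hm n).aemeasurable
  refine le_of_forall_pos_le_add fun ε hε => ?_
  have hsep : T.Separates i {j} ((({i, j} : Finset N).erase j).erase i) := by
    intro a _ b hb
    simp only [Finset.mem_erase, Finset.mem_insert, Finset.mem_singleton] at hb
    tauto
  obtain ⟨κ', _, hmono, hκ'⟩ := exists_supermodular_resample hP hij hsep hsi (half_pos hε) M
  set m := P.map fun x : N → ℝ => x i with hmdef
  let F : ℝ → ℝ → ℝ := fun a t => g (pairPoint i j ![a, t])
  have hFm : Measurable fun p : ℝ × ℝ => F p.1 p.2 := by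
    refine hg.measurable.comp (measurable_pairPoint.comp (measurable_pi_lambda _ fun k => ?_))
    fin_cases k
    · exact measurable_fst
    · exact measurable_snd
  have hFi : ∀ a (ρ : Measure ℝ) [IsFiniteMeasure ρ], Integrable (F a) ρ := fun a ρ _ =>
    Integrable.of_bound (hFm.comp measurable_prodMk_left).aestronglyMeasurable M
      (ae_of_all _ fun _ => hg.bound _)
  -- `C (a, b)` puts `a` into the first argument of `g` and draws the second from `κ' b`. The
  -- diagonal represents the dependent pair, the product measure the independent one.
  let C : ℝ × ℝ → ℝ := fun p => ∫ t, F p.1 t ∂κ' p.2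
  have hCm : Measurable C := by
    have : StronglyMeasurable fun q : (ℝ × ℝ) × ℝ => F q.1.1 q.2 :=
      (hFm.comp ((measurable_fst.comp measurable_fst).prodMk measurable_snd)).stronglyMeasurable
    exact (this.integral_kernel_prod_right' (κ := κ'.comap Prod.snd measurable_snd)).measurable
  have hCb : ∀ p, |C p| ≤ M := fun p => by
    have := norm_integral_le_of_norm_le_const (μ := κ' p.2) (C := M) (f := F p.1)
      (ae_of_all _ fun t => hg.bound _)
    simpa [C] using this
  have hCi : Integrable C (m.prod m) :=
    Integrable.of_bound hCm.aestronglyMeasurable M (ae_of_all _ hCb)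
  have hswap : ∀ a b, C (a, b) + C (b, a) ≤ C (a, a) + C (b, b) := by
    have key : ∀ a b, a ≤ b → C (a, b) + C (b, a) ≤ C (a, a) + C (b, b) := by
      intro a b hab
      have hmon : Monotone fun t => F b t - F a t := by
        intro s t hst
        have := hs.comp_pairPoint (i := i) (j := j) ![b, s] ![a, t]
        have h1 : ![b, s] ⊓ ![a, t] = ![a, s] := by
          ext k; fin_cases k <;> simp [hab, hst]
        have h2 : ![b, s] ⊔ ![a, t] = ![b, t] := by
          ext k; fin_cases k <;> simp [hab, hst]
        rw [h1, h2] at this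
        simp only [F]
        linarith
      have := hmono a b hab _ hmon ((hFi _ _).sub (hFi _ _)) ((hFi _ _).sub (hFi _ _))
      rw [integral_sub (hFi _ _) (hFi _ _), integral_sub (hFi _ _) (hFi _ _)] at this
      simp only [C]
      linarith
    intro a b
    rcases le_total a b with h | h
    · exact key a b h
    · have := key b a h
      linarith
  have hdiag : Integrable (fun a => C (a, a)) m :=
    Integrable.of_bound (hCm.comp (measurable_id.prodMk measurable_id)).aestronglyMeasurable M
      (ae_of_all _ fun a => hCb _)
  have hCs : Integrable (fun p : ℝ × ℝ => C p.swap) (m.prod m) := hCi.swap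
  -- Chebyshev's rearrangement argument: integrate `hswap` over two independent copies of coordinate
  -- `i`.
  have hcheb : ∫ p, C p ∂(m.prod m) ≤ ∫ a, C (a, a) ∂m := by
    have h1 : ∫ p, (C p + C p.swap) ∂(m.prod m) ≤
        ∫ p, (C (p.1, p.1) + C (p.2, p.2)) ∂(m.prod m) :=
      integral_mono (hCi.add hCs) ((hdiag.comp_fst m).add (hdiag.comp_snd m))
        fun p => hswap p.1 p.2
    rw [integral_add hCi hCs, integral_prod_swap,
      integral_add (hdiag.comp_fst m) (hdiag.comp_snd m),
      integral_fun_fst (μ := m) (ν := m) fun a => C (a, a),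
      integral_fun_snd (μ := m) (ν := m) fun a => C (a, a)] at h1
    simp only [probReal_univ, one_smul] at h1
    linarith
  have hgP : |∫ x, g x ∂P - ∫ a, C (a, a) ∂m| ≤ ε / 2 := by
    have h1 := hκ' g (by simpa using hg)
    rw [hmdef, integral_map (hm i).aemeasurable hdiag.aestronglyMeasurable]
    have hx : ∀ x, resample κ' i j g x = C (x i, x i) := fun x => by
      simp only [C, F, resample]
      congr 1 with t
      rw [hg.eq_pairPoint (Function.update x j t)]
      simp [Function.update_of_ne hij]
    simpa only [hx] using h1
  -- With the first argument frozen at `a`, only coordinate `j` is tested, and mixing `κ'` over the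
  -- law of coordinate `i` nearly restores the law of coordinate `j`.
  have hFC : ∀ a, |∫ t, F a t ∂(P.map fun x => x j) - ∫ b, C (a, b) ∂m| ≤ ε / 2 := by
    intro a
    have hFa : Measurable (F a) := hFm.comp measurable_prodMk_left
    have hG : BddMeasOn M (({i, j} : Finset N) : Set N) fun x => F a (x j) :=
      ⟨hFa.comp (hm j), fun x => hg.bound _, fun x y hxy => by
        simp only [hxy j (by simp)]⟩
    have h1 := hκ' _ hG
    have hCa : Measurable fun b => C (a, b) := hCm.comp measurable_prodMk_left
    rw [hmdef, integral_map (hm i).aemeasurable hCa.aestronglyMeasurable,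
      integral_map (hm j).aemeasurable hFa.aestronglyMeasurable]
    have hx : ∀ x, resample κ' i j (fun x => F a (x j)) x = C (a, x i) := fun x => by
      simp [C, resample]
    simpa only [hx] using h1
  have hprod : ∫ x, g x ∂(Measure.infinitePi fun n => P.map fun x => x n) =
      ∫ a, ∫ t, F a t ∂(P.map fun x => x j) ∂m := by
    rw [← integral_prod (fun p : ℝ × ℝ => F p.1 p.2),
      ← Measure.infinitePi_map_eval_prod (P := fun n => P.map fun x : N → ℝ => x n) hij,
      integral_map ((hm i).prodMk (hm j)).aemeasurable hFm.aestronglyMeasurable]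
    · exact integral_congr_ae (ae_of_all _ fun x => hg.eq_pairPoint x)
    · exact Integrable.of_bound hFm.aestronglyMeasurable M (ae_of_all _ fun _ => hg.bound _)
  have hle : ∫ a, ∫ t, F a t ∂(P.map fun x => x j) ∂m ≤ ∫ p, C p ∂(m.prod m) + ε / 2 := by
    rw [integral_prod _ hCi]
    calc ∫ a, ∫ t, F a t ∂(P.map fun x => x j) ∂m
        ≤ ∫ a, (∫ b, C (a, b) ∂m + ε / 2) ∂m := by
          refine integral_mono ?_ (hCi.integral_prod_left.add (integrable_const _)) fun a => ?_
          · exact (Integrable.of_bound (μ := m.prod (P.map fun x => x j))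
              hFm.aestronglyMeasurable M (ae_of_all _ fun _ => hg.bound _)).integral_prod_left
          · linarith [(abs_le.1 (hFC a)).2]
      _ = ∫ a, ∫ b, C (a, b) ∂m ∂m + ε / 2 := by
          rw [integral_add hCi.integral_prod_left (integrable_const _)]
          simp
  rw [hprod]
  linarith [(abs_le.1 hgP).1]

/-! ### Passing to laws -/

section Laws

variable {N Ω : Type*} [MeasurableSpace Ω] {μ : Measure Ω} {X : N → Ω → ℝ}

theorem isProbabilityMeasure_law [IsProbabilityMeasure μ] (hX : ∀ n, Measurable (X n)) :
    IsProbabilityMeasure (law μ X) :=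
  Measure.isProbabilityMeasure_map (measurable_pi_lambda _ hX).aemeasurable

theorem map_law {β : Type*} [MeasurableSpace β] (hX : ∀ n, Measurable (X n)) {φ : (N → ℝ) → β}
    (hφ : Measurable φ) : (law μ X).map φ = μ.map fun ω => φ fun n => X n ω :=
  Measure.map_map hφ (measurable_pi_lambda _ hX)

/-- A conditional distribution is determined by the joint law of the pair, so it is the same for the
coordinate process. -/
theorem stochIncr_law [IsProbabilityMeasure μ] (hX : ∀ n, Measurable (X n)) {i j : N}
    (h : StochIncr μ (X j) (X i)) : StochIncr (law μ X) (fun x => x j) (fun x => x i) := by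
  obtain ⟨s, hs, h⟩ := h
  refine ⟨s, ?_, ?_⟩
  · rwa [map_law hX (measurable_pi_apply i)]
  · rw [condDistrib] at h ⊢
    simpa only [map_law hX ((measurable_pi_apply i).prodMk (measurable_pi_apply j))] using h

theorem law_pair (hX : ∀ n, Measurable (X n)) (i j : N) :
    law μ ![X i, X j] = (law μ X).map fun x => ![x i, x j] := by
  rw [map_law hX]
  · unfold law
    congr 1
    ext ω k
    fin_cases k <;> rfl
  · refine measurable_pi_lambda _ fun k => ?_
    fin_cases k
    · exact measurable_pi_apply i
    · exact measurable_pi_apply j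

theorem indepLaw_eq (hX : ∀ n, Measurable (X n)) :
    indepLaw μ X = Measure.infinitePi fun n => (law μ X).map fun x => x n := by
  unfold indepLaw
  congr 1
  ext1 n
  rw [map_law hX (measurable_pi_apply n)]

theorem indepLaw_pair [IsProbabilityMeasure μ] (hX : ∀ n, Measurable (X n)) {i j : N}
    (hij : i ≠ j) : indepLaw μ ![X i, X j] = (indepLaw μ X).map fun x => ![x i, x j] := by
  have : ∀ n, IsProbabilityMeasure (μ.map (X n)) := fun n =>
    Measure.isProbabilityMeasure_map (hX n).aemeasurable
  have hinj : Function.Injective ![i, j] := by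
    intro a b
    fin_cases a <;> fin_cases b <;> simp [hij, hij.symm]
  have h := Measure.map_infinitePi_infinitePi_of_inj (P := fun n => μ.map (X n)) hinj
  have h1 : (fun (x : N → ℝ) (k : Fin 2) => x (![i, j] k)) = fun x => ![x i, x j] := by
    ext x k
    fin_cases k <;> rfl
  rw [h1] at h
  rw [indepLaw, indepLaw, h]
  congr 1
  ext1 k
  fin_cases k <;> rfl

theorem PSMD.integral_le [IsProbabilityMeasure μ] (hX : ∀ n, Measurable (X n)) {i j : N}
    (hij : i ≠ j) (h : PSMD μ ![X i, X j]) {M : ℝ} {g : (N → ℝ) → ℝ}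
    (hg : BddMeasOn M {i, j} g) (hs : Supermodular g) :
    ∫ x, g x ∂(indepLaw μ X) ≤ ∫ x, g x ∂(law μ X) := by
  classical
  have : ∀ n, IsProbabilityMeasure (μ.map (X n)) := fun n =>
    Measure.isProbabilityMeasure_map (hX n).aemeasurable
  have : IsProbabilityMeasure (indepLaw μ X) := by unfold indepLaw; infer_instance
  rw [PSMD, indepLaw_pair hX hij, law_pair hX] at h
  exact integral_le_of_smLE_pair h hg hs

theorem iIndepFun_indepLaw [IsProbabilityMeasure μ] (hX : ∀ n, Measurable (X n)) :
    iIndepFun (fun n (x : N → ℝ) => x n) (indepLaw μ X) := by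
  have : ∀ n, IsProbabilityMeasure (μ.map (X n)) := fun n =>
    Measure.isProbabilityMeasure_map (hX n).aemeasurable
  exact iIndepFun_infinitePi (P := fun n => μ.map (X n)) (X := fun _ t => t)
    fun _ => measurable_id

end Laws

open DirTree

/-- The comparison of Markov trees, in the direction given by the sign of `σ`. -/
theorem integral_comparison {N : Type*} [Countable N] {T : DirTree N} {P Q : Measure (N → ℝ)}
    [IsProbabilityMeasure P] [IsProbabilityMeasure Q] {R : Set N} (hR : T.IsRootPath R)
    {k : N} (hk : T.E T.root k) (hkR : 2 ≤ T.deg T.root → k ∉ R)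
    (hP : T.IsMarkov P) (hQ : T.IsMarkov Q) {σ : ℝ} (hσ : σ ≠ 0)
    (hPsi : ∀ i j, T.E i j → j ≠ k → StochIncr P (fun x => x j) (fun x => x i))
    (hQup : ∀ i j, T.E i j → j ∉ T.leaves → StochIncr Q (fun x => x i) (fun x => x j))
    (hQdown : ∀ i j, T.E i j → j ∉ R → StochIncr Q (fun x => x j) (fun x => x i))
    (hpair : ∀ i j, T.E i j → ∀ M g, BddMeasOn M {i, j} g → Supermodular g →
      0 ≤ σ * (∫ x, g x ∂Q - ∫ x, g x ∂P))
    (F : Finset N) (M : ℝ) (f : (N → ℝ) → ℝ) (hf : BddMeasOn M (F : Set N) f)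
    (hs : Supermodular f) : 0 ≤ σ * (∫ x, f x ∂Q - ∫ x, f x ∂P) := by
  classical
  -- `k` is added because the induction needs it in `S`.
  obtain ⟨S, hFS, hS⟩ := exists_parentClosed (T := T) (insert k F)
  exact supermodular_comparison hR hk hkR hP hQ hσ hPsi hQup hQdown hpair hS
    (hFS (Finset.mem_insert_self k F))
    (hf.mono fun n hn => hFS (Finset.mem_insert_of_mem hn)) hs

end MarkovTree

end

/-! ### Proof of the theorem -/

open MarkovTree in
theorem theorem1p3 {N : Type*} [Countable N] (T : DirTree N)
    (P : Set N) (hP : T.IsRootPath P)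
    (k : N) (hk : T.E T.root k) (hkP : 2 ≤ T.deg T.root → k ∉ P)
    {Ω Ω' : Type*} [MeasurableSpace Ω] [MeasurableSpace Ω']
    (μ : Measure Ω) [IsProbabilityMeasure μ] (ν : Measure Ω') [IsProbabilityMeasure ν]
    (X : N → Ω → ℝ) (Y : N → Ω' → ℝ)
    (hXm : ∀ n, Measurable (X n)) (hYm : ∀ n, Measurable (Y n))
    (hX : T.IsMarkov (law μ X)) (hY : T.IsMarkov (law ν Y))
    (hXsi : ∀ i j, T.E i j → j ≠ k → StochIncr μ (X j) (X i))
    (hYsi : ∀ i j, T.E i j →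
      (j ∉ T.leaves → StochIncr ν (Y i) (Y j)) ∧ (j ∉ P → StochIncr ν (Y j) (Y i))) :
    ((∀ i j, T.E i j → SmLE (law μ ![X i, X j]) (law ν ![Y i, Y j])) →
      ProcSmLE (law μ X) (law ν Y)) ∧
    ((∀ i j, T.E i j → SmLE (law ν ![Y i, Y j]) (law μ ![X i, X j])) →
      ProcSmLE (law ν Y) (law μ X)) ∧
    (PSMD μ ![X T.root, X k] → ProcPSMD μ X) ∧
    ((∀ i j, T.E i j → j ∈ P → j ∈ T.leaves → PSMD ν ![Y i, Y j]) → ProcPSMD ν Y) := by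
  classical
  have := isProbabilityMeasure_law (μ := μ) hXm
  have := isProbabilityMeasure_law (μ := ν) hYm
  have hXsi' := fun i j hij hjk => stochIncr_law hXm (hXsi i j hij hjk)
  have hYup := fun i j hij hj => stochIncr_law hYm ((hYsi i j hij).1 hj)
  have hYdown := fun i j hij hj => stochIncr_law hYm ((hYsi i j hij).2 hj)
  refine ⟨fun h => ?_, fun h => ?_, fun h => ?_, fun h => ?_⟩
  · refine procSmLE_of_bounded fun F M f hf hs => ?_
    have := integral_comparison hP hk hkP hX hY one_ne_zero hXsi' hYup hYdown
      (fun i j hij M g hg hs => ?_) F M f hf hs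
    · linarith
    · have h1 := h i j hij
      rw [law_pair hXm, law_pair hYm] at h1
      linarith [integral_le_of_smLE_pair h1 hg hs]
  · refine procSmLE_of_bounded fun F M f hf hs => ?_
    have := integral_comparison (σ := -1) hP hk hkP hX hY (by norm_num) hXsi' hYup hYdown
      (fun i j hij M g hg hs => ?_) F M f hf hs
    · linarith
    · have h1 := h i j hij
      rw [law_pair hXm, law_pair hYm] at h1
      linarith [integral_le_of_smLE_pair h1 hg hs]
  · have hind := iIndepFun_indepLaw (μ := μ) hXm
    have := hind.isProbabilityMeasure
    have hsi : ∀ i j, i ≠ j → StochIncr (indepLaw μ X) (fun x => x j) (fun x => x i) :=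
      fun i j hij => stochIncr_of_indepFun (measurable_pi_apply i) (measurable_pi_apply j)
        (hind.indepFun hij)
    refine procSmLE_of_bounded fun F M f hf hs => ?_
    -- Here the independent family takes the place of `Y`, with `σ = -1`. Only the edge to `k` needs
    -- the assumption on the pair; on other edges it follows from stochastic monotonicity of `X`.
    have := integral_comparison (σ := -1) hP hk hkP hX (isMarkov_of_iIndepFun T hind) (by norm_num)
      hXsi' (fun i j hij _ => hsi j i (DirTree.edge_ne hij).symm)
      (fun i j hij _ => hsi i j (DirTree.edge_ne hij)) (fun i j hij M g hg hs => ?_) F M f hf hs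
    · linarith
    · suffices ∫ x, g x ∂(indepLaw μ X) ≤ ∫ x, g x ∂(law μ X) by linarith
      by_cases hjk : j = k
      · subst hjk
        obtain rfl := DirTree.parent_unique hij hk
        exact h.integral_le hXm (DirTree.edge_ne hk) hg hs
      · rw [indepLaw_eq hXm]
        exact integral_infinitePi_le_of_stochIncr hX (DirTree.edge_ne hij) (hXsi' i j hij hjk) hg hs
  · have hind := iIndepFun_indepLaw (μ := ν) hYm
    have := hind.isProbabilityMeasure
    have hsi : ∀ i j, i ≠ j → StochIncr (indepLaw ν Y) (fun x => x j) (fun x => x i) :=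
      fun i j hij => stochIncr_of_indepFun (measurable_pi_apply i) (measurable_pi_apply j)
        (hind.indepFun hij)
    refine procSmLE_of_bounded fun F M f hf hs => ?_
    have := integral_comparison hP hk hkP (isMarkov_of_iIndepFun T hind) hY one_ne_zero
      (fun i j hij _ => hsi i j (DirTree.edge_ne hij)) hYup hYdown
      (fun i j hij M g hg hs => ?_) F M f hf hs
    · linarith
    · suffices ∫ x, g x ∂(indepLaw ν Y) ≤ ∫ x, g x ∂(law ν Y) by linarith
      have hne := DirTree.edge_ne hij
      -- Off `P` the child increases with its parent; on `P`, at a node that is not a leaf, the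
      -- parent increases with its child, and the pair is used in reversed order. Only a leaf on `P`
      -- needs the assumption.
      by_cases hjP : j ∈ P
      · by_cases hjL : j ∈ T.leaves
        · exact (h i j hij hjP hjL).integral_le hYm hne hg hs
        · rw [indepLaw_eq hYm]
          exact integral_infinitePi_le_of_stochIncr hY hne.symm (hYup i j hij hjL)
            (hg.mono (Set.pair_comm i j).subset) hs
      · rw [indepLaw_eq hYm]
        exact integral_infinitePi_le_of_stochIncr hY hne (hYdown i j hij hjP) hg hs
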